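/- Let $\Omega\subset\mathbb C^d$ be an irreducible bounded symmetric domain (in its convex circular realization, so that $0\in\Omega$) with Bergman kernel $\mathrm K$, Euclidean volume $V(\Omega)$ and genus $\gamma$, i.e. $\gamma$ is the positive integer such that $V(\Omega)\mathrm K(z,z)=N(z,\bar z)^{-\gamma}$ on $\Omega$ for an irreducible polynomial $N$ in $z$ and $\bar z$. Let $g_B$ be the Bergman metric of $\Omega$, with Kähler potential $\log\mathrm K(z,z)$, and let $\mathrm N_\Omega(z,z)=(V(\Omega)\mathrm K(z,z))^{-1/\gamma}$ be the generic norm. For a real number $\mu>0$ let $$\mathrm M_\Omega(\mu)=\{(z,w)\in\Omega\times\mathbb C:\ |w|^2<\mathrm N_\Omega^\mu(z,z)\}$$ be the Cartan–Hartogs domain based on $\Omega$, and let $g(\mu)$ be the metric on $\mathrm M_\Omega(\mu)$ with Kähler potential $$\mathrm D_0(z,w)=-\log\big(\mathrm N_\Omega^\mu(z,z)-|w|^2\big).$$ If a real analytic Kähler metric has a real analytic Kähler potential $\Phi$ near a point $p$, with extension $\Phi(z,\bar w)$ holomorphic in $z$ and antiholomorphic in $w$, its diastasis centred at $p$ is the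 function (defined near $p$, independent of the choice of $\Phi$) $\mathrm D_p(z)=\Phi(z,\bar z)+\Phi(p,\bar p)-\Phi(z,\bar p)-\Phi(p,\bar z)$. The metric is called projectively induced if it is $1$-resolvable, that is, if for every point $p$ the infinite matrix $(b_{\alpha\beta})$ of the coefficients of the power expansion $e^{\mathrm D_p(z)}-1=\sum_{\alpha,\beta}b_{\alpha\beta}(z-p)^\alpha\,\overline{(z-p)^\beta}$ around $p$ is positive semidefinite. Then $\mathrm D_0(z,w)$ is, near the origin, the diastasis of $g(\mu)$ centred at the origin. Moreover, for every real $c>0$, the metric $c\,g(\mu)$ on $\mathrm M_\Omega(\mu)$ is projectively induced if and only if the metric $(c+m)\frac{\mu}{\gamma}g_B$ on $\Omega$ is projectively induced for every integer $m\ge 0$. -/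

import Mathlib

open scoped ComplexOrder ComplexConjugate Topology
open MeasureTheory

noncomputable section

namespace CartanHartogs

/-! ### Bounded symmetric domains -/

/-- `Ω` and `Ω'` are biholomorphic. -/
def Biholomorphic {E F : Type*} [NormedAddCommGroup E] [NormedSpace ℂ E]
    [NormedAddCommGroup F] [NormedSpace ℂ F] (Ω : Set E) (Ω' : Set F) : Prop :=
  ∃ (f : E → F) (h : F → E), DifferentiableOn ℂ f Ω ∧ DifferentiableOn ℂ h Ω' ∧
    Set.MapsTo f Ω Ω' ∧ Set.MapsTo h Ω' Ω ∧
    (∀ z ∈ Ω, h (f z) = z) ∧ (∀ w ∈ Ω', f (h w) = w)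

/-- A bounded symmetric domain of `ℂᵈ`, in its convex circular realization: every point is an
isolated fixed point of a holomorphic involution of the domain. -/
structure IsBoundedSymmetricDomain {d : ℕ} (Ω : Set (Fin d → ℂ)) : Prop where
  isOpen : IsOpen Ω
  nonempty : Ω.Nonempty
  isBounded : Bornology.IsBounded Ω
  convex : Convex ℝ Ω
  circular : ∀ z ∈ Ω, ∀ θ : ℝ, Complex.exp (θ * Complex.I) • z ∈ Ω
  symmetric : ∀ p ∈ Ω, ∃ s : (Fin d → ℂ) → (Fin d → ℂ),
    DifferentiableOn ℂ s Ω ∧ Set.MapsTo s Ω Ω ∧ (∀ z ∈ Ω, s (s z) = z) ∧ s p = p ∧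
      ∃ U ∈ 𝓝 p, ∀ z ∈ U ∩ Ω, s z = z → z = p

/-- A bounded symmetric domain (of positive dimension) is irreducible if it is not biholomorphic
to a product of two bounded symmetric domains of positive dimension. -/
def IsIrreducible {d : ℕ} (Ω : Set (Fin d → ℂ)) : Prop :=
  0 < d ∧ ∀ (d₁ d₂ : ℕ) (Ω₁ : Set (Fin d₁ → ℂ)) (Ω₂ : Set (Fin d₂ → ℂ)), 0 < d₁ → 0 < d₂ →
    IsBoundedSymmetricDomain Ω₁ → IsBoundedSymmetricDomain Ω₂ → ¬ Biholomorphic Ω (Ω₁ ×ˢ Ω₂)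

/-! ### The Bergman kernel, the genus and the generic norm -/

/-- The square integrable holomorphic functions on `Ω`. -/
def L2hol {d : ℕ} (Ω : Set (Fin d → ℂ)) : Set ((Fin d → ℂ) → ℂ) :=
  {f | DifferentiableOn ℂ f Ω ∧ MemLp f 2 (volume.restrict Ω)}

/-- `K` is the reproducing kernel of the square integrable holomorphic functions on `Ω`
(normalized to be zero off `Ω × Ω`). -/
def IsBergmanKernel {d : ℕ} (Ω : Set (Fin d → ℂ)) (K : (Fin d → ℂ) → (Fin d → ℂ) → ℂ) : Prop :=
  (∀ z ζ, ¬ (z ∈ Ω ∧ ζ ∈ Ω) → K z ζ = 0) ∧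
  ∀ z ∈ Ω, (fun ζ => conj (K z ζ)) ∈ L2hol Ω ∧
    ∀ f ∈ L2hol Ω, f z = ∫ ζ in Ω, K z ζ * f ζ

/-- The Bergman kernel of `Ω`, that is the unique function satisfying `IsBergmanKernel Ω`. -/
def bergmanKernel {d : ℕ} (Ω : Set (Fin d → ℂ)) : (Fin d → ℂ) → (Fin d → ℂ) → ℂ :=
  Classical.epsilon (IsBergmanKernel Ω)

/-- The function `V(Ω) K(z, z)` (a positive real number for `z` in `Ω`), where `V(Ω)` is the
Euclidean volume. -/
def normalizedKernel {d : ℕ} (Ω : Set (Fin d → ℂ)) (z : Fin d → ℂ) : ℝ :=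
  volume.real Ω * (bergmanKernel Ω z z).re

/-- `γ` is the genus of the irreducible bounded symmetric domain `Ω`: the positive integer for
which `V(Ω) K(z, z) = N(z, z̄) ^ (-γ)` with an irreducible polynomial `N` in `z` and `z̄`. -/
def IsGenus {d : ℕ} (Ω : Set (Fin d → ℂ)) (γ : ℕ) : Prop :=
  0 < γ ∧ ∃ N : MvPolynomial (Fin d ⊕ Fin d) ℂ, Irreducible N ∧
    ∀ z ∈ Ω, MvPolynomial.eval (Sum.elim z (star z)) N ^ γ * (normalizedKernel Ω z : ℂ) = 1

/-- The generic norm `N_Ω(z, z) = (V(Ω) K(z, z)) ^ (-1/γ)`. -/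
def genericNorm {d : ℕ} (Ω : Set (Fin d → ℂ)) (γ : ℕ) (z : Fin d → ℂ) : ℝ :=
  normalizedKernel Ω z ^ (-(1 / (γ : ℝ)))

/-! ### Metrics given by Kähler potentials -/

/-- The Wirtinger derivative `∂/∂z_j`. -/
def dz {n : ℕ} (j : Fin n) (f : (Fin n → ℂ) → ℂ) (z : Fin n → ℂ) : ℂ :=
  (fderiv ℝ f z (Pi.single j 1) - Complex.I * fderiv ℝ f z (Pi.single j Complex.I)) / 2

/-- The Wirtinger derivative `∂/∂z̄_j`. -/
def dzbar {n : ℕ} (j : Fin n) (f : (Fin n → ℂ) → ℂ) (z : Fin n → ℂ) : ℂ :=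
  (fderiv ℝ f z (Pi.single j 1) + Complex.I * fderiv ℝ f z (Pi.single j Complex.I)) / 2

/-- The Hermitian tensor `g_{j k̄} = ∂²Φ / ∂z_j ∂z̄_k` with Kähler potential `Φ`. -/
def metricOfPotential {n : ℕ} (Φ : (Fin n → ℂ) → ℝ) (z : Fin n → ℂ) : Matrix (Fin n) (Fin n) ℂ :=
  fun j k => dz j (dzbar k (fun x => (Φ x : ℂ))) z

/-- The Bergman metric of `Ω`, with Kähler potential `log K(z, z)`. -/
def bergmanMetric {d : ℕ} (Ω : Set (Fin d → ℂ)) : (Fin d → ℂ) → Matrix (Fin d) (Fin d) ℂ :=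
  metricOfPotential fun z => Real.log (bergmanKernel Ω z z).re

/-! ### Diastasis and projectively induced metrics -/

/-- `D` is, near `p`, the diastasis function centred at `p` of the real analytic Kähler metric `g`:
`D(z) = Φ(z, z̄) + Φ(p, p̄) - Φ(z, p̄) - Φ(p, z̄)`, where `Φ` is a Kähler potential of `g` near `p`
and `G z w` is its extension `Φ(z, w̄)`, holomorphic in `z` and antiholomorphic in `w`. -/
def IsDiastasisAt {n : ℕ} (g : (Fin n → ℂ) → Matrix (Fin n) (Fin n) ℂ) (p : Fin n → ℂ)
    (D : (Fin n → ℂ) → ℝ) : Prop :=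
  ∃ (U : Set (Fin n → ℂ)) (Φ : (Fin n → ℂ) → ℝ) (G : (Fin n → ℂ) → (Fin n → ℂ) → ℂ),
    IsOpen U ∧ p ∈ U ∧
    (∀ z ∈ U, metricOfPotential Φ z = g z) ∧
    AnalyticOnNhd ℂ (fun x : (Fin n → ℂ) × (Fin n → ℂ) => G x.1 (star x.2))
      {x | x.1 ∈ U ∧ star x.2 ∈ U} ∧
    (∀ z ∈ U, G z z = Φ z) ∧
    ∀ z ∈ U, (D z : ℂ) = G z z + G p p - G z p - G p z

/-- The monomial `z ^ α`. -/
def monomial {n : ℕ} (α : Fin n → ℕ) (z : Fin n → ℂ) : ℂ := ∏ i, z i ^ α i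

/-- `g` is `1`-resolvable at `p`: the infinite matrix `b` of coefficients in the power expansion
`exp(D_p(z)) - 1 = ∑ b_{α β} (z - p) ^ α conj((z - p) ^ β)` around `p` of the diastasis `D_p` is
positive semidefinite. -/
def IsOneResolvableAt {n : ℕ} (g : (Fin n → ℂ) → Matrix (Fin n) (Fin n) ℂ) (p : Fin n → ℂ) :
    Prop :=
  ∃ (D : (Fin n → ℂ) → ℝ) (b : Matrix (Fin n → ℕ) (Fin n → ℕ) ℂ),
    IsDiastasisAt g p D ∧
    (∀ᶠ z in 𝓝 p, HasSum
      (fun m : (Fin n → ℕ) × (Fin n → ℕ) =>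
        b m.1 m.2 * monomial m.1 (z - p) * conj (monomial m.2 (z - p)))
      ((Real.exp (D z) - 1 : ℝ) : ℂ)) ∧
    b.PosSemidef

/-- The metric `g` on the domain `M` is projectively induced, i.e. `1`-resolvable (of some finite or
infinite rank) at every point of `M`. -/
def IsProjectivelyInduced {n : ℕ} (M : Set (Fin n → ℂ))
    (g : (Fin n → ℂ) → Matrix (Fin n) (Fin n) ℂ) : Prop :=
  ∀ p ∈ M, IsOneResolvableAt g p

/-! ### Cartan–Hartogs domains -/

/-- The component `z` of a point `(z, w)` of `ℂᵈ × ℂ = ℂᵈ⁺¹`. -/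
def base {d : ℕ} (x : Fin (d + 1) → ℂ) : Fin d → ℂ := fun i => x i.castSucc

/-- The Cartan–Hartogs domain `{(z, w) | z ∈ Ω, |w|² < N_Ω(z, z) ^ μ}` in `ℂᵈ⁺¹`. -/
def domain {d : ℕ} (Ω : Set (Fin d → ℂ)) (γ : ℕ) (μ : ℝ) : Set (Fin (d + 1) → ℂ) :=
  {x | base x ∈ Ω ∧ ‖x (Fin.last d)‖ ^ 2 < genericNorm Ω γ (base x) ^ μ}

/-- The potential `-log(N_Ω(z, z) ^ μ - |w|²)`. -/
def potential {d : ℕ} (Ω : Set (Fin d → ℂ)) (γ : ℕ) (μ : ℝ) (x : Fin (d + 1) → ℂ) : ℝ :=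
  -Real.log (genericNorm Ω γ (base x) ^ μ - ‖x (Fin.last d)‖ ^ 2)

/-- The metric `g(μ)` of the Cartan–Hartogs domain. -/
def metric {d : ℕ} (Ω : Set (Fin d → ℂ)) (γ : ℕ) (μ : ℝ) :
    (Fin (d + 1) → ℂ) → Matrix (Fin (d + 1)) (Fin (d + 1)) ℂ :=
  metricOfPotential (potential Ω γ μ)

end CartanHartogs

end

open scoped ComplexOrder ComplexConjugate Topology
open MeasureTheory

noncomputable section

namespace CartanHartogs

/-! ### Absolutely convergent expansions on polydiscs -/

/-! Let `l` be the polarization of `(μ/γ) log (V(Ω) K)`. The potential of `g(μ)` polarizes to `l -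
log (1 - w w' e^l)`, so the binomial series gives, for the exponential of `c` times it, `∑ a_m (w
w')^m e^{(c+m) l}` with `a_m = c(c+1)⋯(c+m-1)/m! > 0`. Here `e^{(c+m) l}` is the exponential of a
polarized potential of `(c+m)(μ/γ) g_B`. Around a point `(p, w₀)` this becomes an identity of
coefficient matrices (`exists_hasExp_fibration`): the total matrix is `∑ a_m k_m ⊗ v_m v_m^*`, where
`v_m` lists the coefficients of `(w₀ + x)^m`. If every `k_m` is positive semidefinite, so is the
sum. Conversely, for `w₀ = 0` the block with both last exponents equal to `m` is `a_m k_m`, so the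
points of `Ω × {0}` already determine all the `k_m`.

To apply this, resolvability has to be read off from the exponential of any potential
(`isOneResolvableAt_iff`). Passing to the diastasis multiplies that exponential by `|f|²` with `f`
holomorphic and zero-free, which preserves semidefiniteness (`posSemidef_cauchyMul`), and the `-1`
only removes a decoupled entry. Behind this lie two uniqueness facts: the values on the antidiagonal
determine the coefficients (`eq_zero_of_hasSum_star`), and the metric determines the diastasis
(`IsDiastasisAt.eventually_eq`).

The polarization `l` comes from the polynomial in the definition of the genus. The Bergman kernel is
constructed by projection onto the closed space of square integrable holomorphic functions. Its
rotation invariance and the value `V(Ω) K(0, 0) = 1` make `D₀` its own diastasis at the origin,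
because invariance kills the terms in `z` alone and in `z̄` alone. -/

/-- The total degree of a multi-index. -/
@[irreducible] def mdeg {n : ℕ} (α : Fin n → ℕ) : ℕ := ∑ i, α i

/-- `F x y = ∑ b_{αβ} x ^ α y ^ β` with absolute convergence on the polydisc of radius `r`. -/
structure HasExp {n : ℕ} (b : Matrix (Fin n → ℕ) (Fin n → ℕ) ℂ) (r : ℝ)
    (F : (Fin n → ℂ) → (Fin n → ℂ) → ℂ) : Prop where
  summable : Summable fun m : (Fin n → ℕ) × (Fin n → ℕ) =>
    ‖b m.1 m.2‖ * r ^ (mdeg m.1 + mdeg m.2)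
  hasSum : ∀ x y, ‖x‖ ≤ r → ‖y‖ ≤ r →
    HasSum (fun m : (Fin n → ℕ) × (Fin n → ℕ) =>
      b m.1 m.2 * monomial m.1 x * monomial m.2 y) (F x y)

lemma norm_monomial_le {n : ℕ} (α : Fin n → ℕ) {x : Fin n → ℂ} {r : ℝ} (hx : ‖x‖ ≤ r) :
    ‖monomial α x‖ ≤ r ^ mdeg α := by
  rw [monomial, norm_prod, mdeg, ← Finset.prod_pow_eq_pow_sum]
  refine Finset.prod_le_prod (fun _ _ => norm_nonneg _) fun i _ => ?_
  rw [norm_pow]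
  exact pow_le_pow_left₀ (norm_nonneg _) ((norm_le_pi_norm x i).trans hx) _

lemma monomial_smul {n : ℕ} (α : Fin n → ℕ) (t : ℂ) (x : Fin n → ℂ) :
    monomial α (t • x) = t ^ mdeg α * monomial α x := by
  simp only [monomial, mdeg, Pi.smul_apply, smul_eq_mul, mul_pow, Finset.prod_mul_distrib,
    Finset.prod_pow_eq_pow_sum]

lemma monomial_star {n : ℕ} (α : Fin n → ℕ) (x : Fin n → ℂ) :
    monomial α (star x) = conj (monomial α x) := by
  simp [monomial, map_prod]

lemma monomial_add {n : ℕ} (α β : Fin n → ℕ) (x : Fin n → ℂ) :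
    monomial (α + β) x = monomial α x * monomial β x := by
  simp [monomial, pow_add, Finset.prod_mul_distrib]

lemma mdeg_add {n : ℕ} (α β : Fin n → ℕ) : mdeg (α + β) = mdeg α + mdeg β := by
  simp [mdeg, Finset.sum_add_distrib]

lemma mdeg_zero {n : ℕ} : mdeg (0 : Fin n → ℕ) = 0 := by simp [mdeg]

lemma mdeg_eq_zero {n : ℕ} {α : Fin n → ℕ} : mdeg α = 0 ↔ α = 0 := by
  simp [mdeg, funext_iff]

lemma monomial_zero {n : ℕ} (x : Fin n → ℂ) : monomial (0 : Fin n → ℕ) x = 1 := by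
  simp [monomial]

lemma norm_term_le {n : ℕ} (b : Matrix (Fin n → ℕ) (Fin n → ℕ) ℂ) {r : ℝ} {x y : Fin n → ℂ}
    (hx : ‖x‖ ≤ r) (hy : ‖y‖ ≤ r) (m : (Fin n → ℕ) × (Fin n → ℕ)) :
    ‖b m.1 m.2 * monomial m.1 x * monomial m.2 y‖ ≤ ‖b m.1 m.2‖ * r ^ (mdeg m.1 + mdeg m.2) := by
  rw [norm_mul, norm_mul, pow_add, mul_assoc]
  have hr : 0 ≤ r := (norm_nonneg _).trans hx
  gcongr
  · exact norm_monomial_le _ hx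
  · exact norm_monomial_le _ hy

lemma HasExp.mono {n : ℕ} {b : Matrix (Fin n → ℕ) (Fin n → ℕ) ℂ} {r r' : ℝ}
    {F : (Fin n → ℂ) → (Fin n → ℂ) → ℂ} (h : HasExp b r F) (h0 : 0 ≤ r') (hr : r' ≤ r) :
    HasExp b r' F where
  summable := h.summable.of_nonneg_of_le (fun _ => by positivity) fun m => by gcongr
  hasSum x y hx hy := h.hasSum x y (hx.trans hr) (hy.trans hr)

lemma HasExp.congr {n : ℕ} {b : Matrix (Fin n → ℕ) (Fin n → ℕ) ℂ} {r : ℝ}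
    {F F' : (Fin n → ℂ) → (Fin n → ℂ) → ℂ} (h : HasExp b r F)
    (hF : ∀ x y, ‖x‖ ≤ r → ‖y‖ ≤ r → F x y = F' x y) : HasExp b r F' where
  summable := h.summable
  hasSum x y hx hy := hF x y hx hy ▸ h.hasSum x y hx hy

/-- The pair of multi-indices counting the letters of a word. -/
def wordIndex {n k : ℕ} (f : Fin k → Fin n ⊕ Fin n) : (Fin n → ℕ) × (Fin n → ℕ) :=
  (fun i => (Finset.univ.filter fun j => f j = Sum.inl i).card,
    fun i => (Finset.univ.filter fun j => f j = Sum.inr i).card)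

/-- The unit vectors of `ℂⁿ × ℂⁿ`. -/
def pairBasis {n : ℕ} : Fin n ⊕ Fin n → (Fin n → ℂ) × (Fin n → ℂ)
  | Sum.inl i => (Pi.single i 1, 0)
  | Sum.inr i => (0, Pi.single i 1)

lemma norm_pairBasis_le {n : ℕ} (s : Fin n ⊕ Fin n) : ‖(pairBasis s : _ × _)‖ ≤ 1 := by
  rcases s with i | i <;> simp [pairBasis, Prod.norm_def, Pi.norm_single]

lemma sum_pairBasis {n : ℕ} (x y : Fin n → ℂ) :
    ∑ s, Sum.elim x y s • pairBasis s = (x, y) := by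
  rw [Fintype.sum_sum_type]
  ext i <;> simp [pairBasis, Prod.fst_sum, Prod.snd_sum, Finset.sum_apply, Pi.single_apply]

lemma prod_word {n k : ℕ} (f : Fin k → Fin n ⊕ Fin n) (x y : Fin n → ℂ) :
    ∏ j, Sum.elim x y (f j) = monomial (wordIndex f).1 x * monomial (wordIndex f).2 y := by
  rw [← Finset.prod_fiberwise_of_maps_to (s := Finset.univ) (t := Finset.univ) (g := f)
    (fun _ _ => Finset.mem_univ _), Fintype.prod_sum_type]
  congr 1
  all_goals
    refine Finset.prod_congr rfl fun i _ => ?_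
    rw [Finset.prod_congr rfl (g := fun _ => _) (fun j hj => by rw [(Finset.mem_filter.1 hj).2]),
      Finset.prod_const]
    rfl

lemma mdeg_wordIndex {n k : ℕ} (f : Fin k → Fin n ⊕ Fin n) :
    mdeg (wordIndex f).1 + mdeg (wordIndex f).2 = k := by
  simp only [mdeg, wordIndex]
  rw [← Fintype.sum_sum_type
    (fun s : Fin n ⊕ Fin n => (Finset.univ.filter fun j => f j = s).card)]
  simpa using (Finset.card_eq_sum_card_fiberwise (s := Finset.univ) (t := Finset.univ) (f := f)
    (fun _ _ => by simp)).symm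

/-- Multilinearity expands the degree `k` term of the power series over words of length `k` in the
`2n` unit vectors. After shrinking the radius the sum over all words converges absolutely, and
collecting words with equal letter counts yields the coefficients. -/
theorem exists_hasExp {n : ℕ} {F : (Fin n → ℂ) × (Fin n → ℂ) → ℂ} {p q : Fin n → ℂ}
    (hF : AnalyticAt ℂ F (p, q)) :
    ∃ r > 0, ∃ b, HasExp b r fun x y => F (p + x, q + y) := by
  obtain ⟨P, R, hP⟩ := hF
  obtain ⟨ρ, hρ0, hρR⟩ := ENNReal.lt_iff_exists_nnreal_btwn.1 hP.r_pos
  have hρ0' : 0 < ρ := by exact_mod_cast hρ0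
  obtain ⟨C, hC0, hC⟩ := P.norm_mul_pow_le_of_lt_radius (hρR.trans_le hP.r_le)
  -- This gives `2n r ≤ ρ / 2`, so the `(2n)^k` words of length `k` are absorbed and a factor
  -- `(1/2)^k` remains.
  set r : ℝ := ρ / (4 * n + 4) with hr
  have hn : (0 : ℝ) < 4 * n + 4 := by positivity
  have hρ0'' : (0 : ℝ) < ρ := hρ0'
  have hr0 : 0 < r := by positivity
  have hrρ : r < ρ := by
    rw [hr, div_lt_iff₀ hn]
    nlinarith [(Nat.cast_nonneg n : (0 : ℝ) ≤ n)]
  let W := Σ k : ℕ, (Fin k → Fin n ⊕ Fin n)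
  let co : W → ℂ := fun w => P w.1 fun j => pairBasis (w.2 j)
  have hco : ∀ w, ‖co w‖ ≤ ‖P w.1‖ := fun w => by
    refine (ContinuousMultilinearMap.le_opNorm _ _).trans ?_
    refine mul_le_of_le_one_right (norm_nonneg _) ?_
    exact Finset.prod_le_one (fun _ _ => norm_nonneg _) fun _ _ => norm_pairBasis_le _
  have hW : Summable fun w : W => ‖co w‖ * r ^ w.1 := by
    have : Summable fun w : W => ‖P w.1‖ * r ^ w.1 := by
      rw [summable_sigma_of_nonneg (fun _ => by positivity)]
      refine ⟨fun k => (hasSum_fintype _).summable, ?_⟩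
      simp only [tsum_fintype]
      refine Summable.of_nonneg_of_le (fun _ => by positivity) (fun k => ?_)
        ((summable_geometric_two).mul_left C)
      have h1 : ((n + n : ℕ) : ℝ) * r ≤ ρ * (1 / 2) := by
        rw [hr]; push_cast; rw [mul_div_assoc', div_le_iff₀ hn]; nlinarith
      calc ∑ _f : Fin k → Fin n ⊕ Fin n, ‖P k‖ * r ^ k = ‖P k‖ * (((n + n : ℕ) : ℝ) * r) ^ k := by
            simp [mul_pow]; ring
        _ ≤ ‖P k‖ * (ρ * (1 / 2)) ^ k := by gcongr
        _ = (‖P k‖ * ρ ^ k) * (1 / 2) ^ k := by rw [mul_pow]; ring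
        _ ≤ C * (1 / 2) ^ k := by gcongr; exact hC k
    exact this.of_nonneg_of_le (fun _ => by positivity) fun w => by gcongr; exact hco w
  let ix : W → (Fin n → ℕ) × (Fin n → ℕ) := fun w => wordIndex w.2
  let e := Equiv.sigmaFiberEquiv ix
  have hfib : ∀ c, ∀ w : {w // ix w = c}, w.1.1 = mdeg c.1 + mdeg c.2 := by
    rintro _ ⟨w, rfl⟩
    exact (mdeg_wordIndex w.2).symm
  have hWe : Summable fun w : (Σ c, {w // ix w = c}) =>
      ‖co w.2‖ * r ^ (mdeg w.1.1 + mdeg w.1.2) := by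
    refine (e.summable_iff.2 hW).congr fun w => ?_
    rw [← hfib]; rfl
  refine ⟨r, hr0, fun α β => ∑' w : {w // ix w = (α, β)}, co w, ?_, ?_⟩
  · refine hWe.sigma.of_nonneg_of_le (fun _ => by positivity) fun c => ?_
    have h1 : Summable fun w : {w // ix w = c} => ‖co w‖ := by
      have := hWe.sigma_factor c
      simp only [] at this
      exact (summable_mul_right_iff (pow_pos hr0 _).ne').1 this
    change _ ≤ ∑' w : {w // ix w = c}, ‖co w‖ * r ^ (mdeg c.1 + mdeg c.2)
    rw [tsum_mul_right]
    gcongr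
    exact norm_tsum_le_tsum_norm h1
  · intro x y hx hy
    have hbound : ∀ w : W, ‖co w * ∏ j, Sum.elim x y (w.2 j)‖ ≤ ‖co w‖ * r ^ w.1 := fun w => by
      rw [norm_mul, norm_prod]
      gcongr
      refine (Finset.prod_le_prod (fun _ _ => norm_nonneg _)
        (g := fun _ => r) fun j _ => ?_).trans (by simp)
      rcases w.2 j with i | i
      · exact (norm_le_pi_norm x i).trans hx
      · exact (norm_le_pi_norm y i).trans hy
    have hs : Summable fun w : W => co w * ∏ j, Sum.elim x y (w.2 j) :=
      Summable.of_norm_bounded hW hbound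
    have hsum : HasSum (fun w : W => co w * ∏ j, Sum.elim x y (w.2 j)) (F (p + x, q + y)) := by
      have h1 := hP.hasSum (y := (x, y)) (by
        rw [Metric.mem_eball, edist_zero_right]
        refine lt_of_le_of_lt ?_ hρR
        rw [enorm_eq_nnnorm]
        norm_cast
        rw [← NNReal.coe_le_coe, coe_nnnorm, Prod.norm_def]
        exact (max_le hx hy).trans hrρ.le)
      rw [Prod.mk_add_mk] at h1
      -- The same absolutely convergent family is summed twice: by word length here, which recovers
      -- the power series, and by letter count below.
      have h2 := hs.hasSum.sigma fun k => (hs.sigma_factor k).hasSum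
      have h3 : ∀ k, ∑' f : Fin k → Fin n ⊕ Fin n, co ⟨k, f⟩ * ∏ j, Sum.elim x y (f j) =
          P k fun _ => (x, y) := fun k => by
        rw [tsum_fintype, ← sum_pairBasis x y, ContinuousMultilinearMap.map_sum]
        refine Finset.sum_congr rfl fun f _ => ?_
        rw [ContinuousMultilinearMap.map_smul_univ, smul_eq_mul, mul_comm]
      simp only [h3] at h2
      rw [← h2.unique h1]
      exact hs.hasSum
    have h1 := e.hasSum_iff.2 hsum
    have h2 := h1.sigma fun c => (h1.summable.sigma_factor c).hasSum
    refine h2.congr_fun ?_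
    rintro ⟨α, β⟩
    rw [mul_assoc, ← tsum_mul_right]
    refine tsum_congr fun w => ?_
    have hw : wordIndex w.1.2 = (α, β) := w.2
    change _ = co w.1 * ∏ j, Sum.elim x y (w.1.2 j)
    rw [prod_word, hw]

/-! ### Uniqueness of expansions on the antidiagonal -/

/-- Pairs of multi-indices as exponents of polynomials in `z` and `z̄`. -/
def expEquiv (n : ℕ) : (Fin n ⊕ Fin n →₀ ℕ) ≃ (Fin n → ℕ) × (Fin n → ℕ) :=
  Finsupp.equivFunOnFinite.trans (Equiv.sumArrowEquivProdArrow _ _ _)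

lemma degree_expEquiv {n : ℕ} (m : Fin n ⊕ Fin n →₀ ℕ) :
    mdeg (expEquiv n m).1 + mdeg (expEquiv n m).2 = ∑ s, m s := by
  rw [Fintype.sum_sum_type, mdeg, mdeg]; rfl

/-- The homogeneous part of degree `k` of an expansion. -/
def homogPart {n : ℕ} (b : Matrix (Fin n → ℕ) (Fin n → ℕ) ℂ) (k : ℕ) :
    MvPolynomial (Fin n ⊕ Fin n) ℂ :=
  ∑ m ∈ Finset.finsuppAntidiag Finset.univ k,
    MvPolynomial.monomial m (b (expEquiv n m).1 (expEquiv n m).2)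

lemma eval_homogPart {n : ℕ} (b : Matrix (Fin n → ℕ) (Fin n → ℕ) ℂ) (k : ℕ) (x y : Fin n → ℂ) :
    MvPolynomial.eval (Sum.elim x y) (homogPart b k) =
      ∑ m ∈ Finset.finsuppAntidiag Finset.univ k, b (expEquiv n m).1 (expEquiv n m).2 *
        monomial (expEquiv n m).1 x * monomial (expEquiv n m).2 y := by
  rw [homogPart, map_sum]
  refine Finset.sum_congr rfl fun m _ => ?_
  rw [MvPolynomial.eval_monomial, Finsupp.prod_fintype _ _ (by simp), Fintype.prod_sum_type,
    mul_assoc]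
  rfl

lemma eq_zero_of_hasSum_pow {q : ℕ → ℂ}
    (h : ∀ t : ℝ, |t| < 1 → HasSum (fun k => (t : ℂ) ^ k * q k) 0) : q = 0 := by
  let p : FormalMultilinearSeries ℝ ℝ ℂ := fun k =>
    ContinuousMultilinearMap.mkPiRing ℝ (Fin k) (q k)
  have h1 : HasFPowerSeriesAt (fun _ : ℝ => (0 : ℂ)) p 0 := by
    refine hasFPowerSeriesAt_iff.2 ?_
    filter_upwards [Metric.ball_mem_nhds (0 : ℝ) one_pos] with t ht
    refine (h t (by simpa using ht)).congr_fun fun k => ?_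
    simp [p, FormalMultilinearSeries.coeff, Complex.real_smul]
  have h2 := h1.eq_zero
  funext k
  have h3 := congrArg (fun p => FormalMultilinearSeries.coeff p k) h2
  simpa [p, FormalMultilinearSeries.coeff] using h3

/-- The invertible substitution `(u, v) ↦ (u + iv, u - iv)` carries real points to the antidiagonal.
The transformed polynomial vanishes on a product of real intervals, hence identically. -/
lemma eq_zero_of_eval_star {n : ℕ} {Q : MvPolynomial (Fin n ⊕ Fin n) ℂ} {r : ℝ} (hr : 0 < r)
    (h : ∀ x : Fin n → ℂ, ‖x‖ < r → MvPolynomial.eval (Sum.elim x (star x)) Q = 0) : Q = 0 := by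
  let g : Fin n ⊕ Fin n → MvPolynomial (Fin n ⊕ Fin n) ℂ :=
    Sum.elim (fun i => MvPolynomial.X (Sum.inl i) + MvPolynomial.C Complex.I *
        MvPolynomial.X (Sum.inr i))
      (fun i => MvPolynomial.X (Sum.inl i) - MvPolynomial.C Complex.I *
        MvPolynomial.X (Sum.inr i))
  have hg : ∀ u v : Fin n → ℂ, MvPolynomial.eval (Sum.elim u v) (MvPolynomial.bind₁ g Q) =
      MvPolynomial.eval (Sum.elim (u + Complex.I • v) (u - Complex.I • v)) Q := fun u v => by
    refine (MvPolynomial.eval₂Hom_bind₁ _ _ _ _).trans ?_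
    rw [MvPolynomial.eval]
    congr 2
    funext s
    rcases s with i | i <;> simp [g]
  have h0 : MvPolynomial.bind₁ g Q = 0 := by
    -- Half the radius for each of the real and imaginary parts keeps `u + iv` in the ball of radius
    -- `r`.
    refine MvPolynomial.funext_set (fun _ => (fun t : ℝ => (t : ℂ)) '' Set.Ioo (-(r / 2)) (r / 2))
      (fun _ => (Set.Ioo_infinite (by linarith)).image Complex.ofReal_injective.injOn)
      fun x hx => ?_
    choose t ht htx using fun s => hx s trivial
    have hx' : x = Sum.elim (fun i => (t (Sum.inl i) : ℂ)) (fun i => (t (Sum.inr i) : ℂ)) := by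
      funext s; rcases s with i | i <;> exact (htx _).symm
    rw [hx', hg, map_zero]
    have hs : ((fun i => (t (Sum.inl i) : ℂ)) - Complex.I • fun i => (t (Sum.inr i) : ℂ)) =
        star ((fun i => (t (Sum.inl i) : ℂ)) + Complex.I • fun i => (t (Sum.inr i) : ℂ)) := by
      funext i; simp [sub_eq_add_neg]
    rw [hs]
    refine h _ ((pi_norm_lt_iff hr).2 fun i => ?_)
    refine (norm_add_le _ _).trans_lt ?_
    have h1 := abs_lt.2 (ht (Sum.inl i))
    have h2 := abs_lt.2 (ht (Sum.inr i))
    simp only [Pi.smul_apply, smul_eq_mul, norm_mul, Complex.norm_I, one_mul, Complex.norm_real,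
      Real.norm_eq_abs]
    linarith
  refine MvPolynomial.funext fun x => ?_
  rw [map_zero]
  -- The preimage of an arbitrary point under the substitution.
  have h1 := hg ((1 / 2 : ℂ) • ((x ∘ Sum.inl) + (x ∘ Sum.inr)))
    ((-Complex.I / 2) • ((x ∘ Sum.inl) - (x ∘ Sum.inr)))
  rw [h0, map_zero] at h1
  rw [h1]
  congr 2
  funext s
  rcases s with i | i <;> simp <;> ring_nf <;> simp <;> ring

/-- Along a real ray `t x` the terms of total degree `k` combine to `t^k Q_k(x, x̄)`. Uniqueness in
the single variable `t` kills each `Q_k(x, x̄)`, and then the polynomial `Q_k`. -/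
theorem eq_zero_of_hasSum_star {n : ℕ} {b : Matrix (Fin n → ℕ) (Fin n → ℕ) ℂ}
    (h : ∀ᶠ x in 𝓝 (0 : Fin n → ℂ),
      HasSum (fun m : (Fin n → ℕ) × (Fin n → ℕ) =>
        b m.1 m.2 * monomial m.1 x * conj (monomial m.2 x)) 0) : b = 0 := by
  obtain ⟨r, hr, hb⟩ := Metric.eventually_nhds_iff.1 h
  have hQ : ∀ k, homogPart b k = 0 := by
    intro k
    refine eq_zero_of_eval_star hr fun x hx => ?_
    refine congrFun (eq_zero_of_hasSum_pow
      (q := fun k => MvPolynomial.eval (Sum.elim x (star x)) (homogPart b k)) fun t ht => ?_) k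
    have h1 := hb (y := (t : ℂ) • x) (by
      rw [dist_zero_right, norm_smul, Complex.norm_real, Real.norm_eq_abs]
      nlinarith [norm_nonneg x, abs_nonneg t])
    rw [← (expEquiv n).hasSum_iff] at h1
    rw [← (Equiv.sigmaFiberEquiv (fun m : Fin n ⊕ Fin n →₀ ℕ => ∑ s, m s)).hasSum_iff] at h1
    refine (h1.sigma fun k => (h1.summable.sigma_factor k).hasSum).congr_fun fun k => ?_
    rw [eval_homogPart, Finset.mul_sum, ← Finset.tsum_subtype (Finset.finsuppAntidiag Finset.univ k)
      (fun m => (t : ℂ) ^ k * (b (expEquiv n m).1 (expEquiv n m).2 *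
        monomial (expEquiv n m).1 x * monomial (expEquiv n m).2 (star x)))]
    let e : {m : Fin n ⊕ Fin n →₀ ℕ // ∑ s, m s = k} ≃
        {m // m ∈ Finset.finsuppAntidiag Finset.univ k} :=
      Equiv.subtypeEquivRight fun m => by simp
    rw [← e.tsum_eq]
    refine tsum_congr fun m => ?_
    have hm : mdeg (expEquiv n m.1).1 + mdeg (expEquiv n m.1).2 = k :=
      (degree_expEquiv _).trans m.2
    change _ * (b (expEquiv n m.1).1 (expEquiv n m.1).2 * monomial (expEquiv n m.1).1 _ *
        monomial (expEquiv n m.1).2 _) = b (expEquiv n m.1).1 (expEquiv n m.1).2 *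
      monomial (expEquiv n m.1).1 _ * conj (monomial (expEquiv n m.1).2 _)
    have hk : (t : ℂ) ^ k = t ^ mdeg (expEquiv n m.1).1 * t ^ mdeg (expEquiv n m.1).2 := by
      rw [← pow_add, hm]
    rw [monomial_smul, monomial_smul, monomial_star, hk]
    simp only [map_mul, map_pow, Complex.conj_ofReal]
    ring
  ext α β
  have h1 := congrArg (MvPolynomial.coeff ((expEquiv n).symm (α, β)))
    (hQ (∑ s, (expEquiv n).symm (α, β) s))
  simpa [homogPart, MvPolynomial.coeff_sum, MvPolynomial.coeff_monomial] using h1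

lemma HasExp.eventually_hasSum {n : ℕ} {b : Matrix (Fin n → ℕ) (Fin n → ℕ) ℂ} {r : ℝ}
    {F : (Fin n → ℂ) → (Fin n → ℂ) → ℂ} (h : HasExp b r F) (hr : 0 < r) :
    ∀ᶠ x in 𝓝 (0 : Fin n → ℂ),
      HasSum (fun m : (Fin n → ℕ) × (Fin n → ℕ) =>
        b m.1 m.2 * monomial m.1 x * conj (monomial m.2 x)) (F x (star x)) := by
  filter_upwards [Metric.ball_mem_nhds _ hr] with x hx
  have hx' : ‖x‖ ≤ r := (mem_ball_zero_iff.1 hx).le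
  simp only [← monomial_star]
  exact h.hasSum x (star x) hx' (by rwa [norm_star])

theorem eq_of_hasSum_star {n : ℕ} {b b' : Matrix (Fin n → ℕ) (Fin n → ℕ) ℂ}
    {f : (Fin n → ℂ) → ℂ}
    (h : ∀ᶠ x in 𝓝 (0 : Fin n → ℂ), HasSum (fun m : (Fin n → ℕ) × (Fin n → ℕ) =>
        b m.1 m.2 * monomial m.1 x * conj (monomial m.2 x)) (f x))
    (h' : ∀ᶠ x in 𝓝 (0 : Fin n → ℂ), HasSum (fun m : (Fin n → ℕ) × (Fin n → ℕ) =>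
        b' m.1 m.2 * monomial m.1 x * conj (monomial m.2 x)) (f x)) : b = b' := by
  rw [← sub_eq_zero]
  refine eq_zero_of_hasSum_star ?_
  filter_upwards [h, h'] with x hx hx'
  have := hx.sub hx'
  rw [sub_self] at this
  refine this.congr_fun fun m => ?_
  simp only [Matrix.sub_apply]; ring

theorem HasExp.unique {n : ℕ} {b b' : Matrix (Fin n → ℕ) (Fin n → ℕ) ℂ} {r r' : ℝ}
    {F F' : (Fin n → ℂ) → (Fin n → ℂ) → ℂ} (h : HasExp b r F) (h' : HasExp b' r' F')
    (hr : 0 < r) (hr' : 0 < r')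
    (hFF' : ∀ᶠ x in 𝓝 (0 : Fin n → ℂ), F x (star x) = F' x (star x)) : b = b' := by
  refine eq_of_hasSum_star (h.eventually_hasSum hr) ?_
  filter_upwards [h'.eventually_hasSum hr', hFF'] with x hx hx'
  rwa [hx']

lemma HasExp.conj_swap {n : ℕ} {b : Matrix (Fin n → ℕ) (Fin n → ℕ) ℂ} {r : ℝ}
    {F : (Fin n → ℂ) → (Fin n → ℂ) → ℂ} (h : HasExp b r F) :
    HasExp b.conjTranspose r fun x y => conj (F (star y) (star x)) where
  summable := by
    rw [← (Equiv.prodComm _ _).summable_iff]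
    refine h.summable.congr fun m => ?_
    simp [Matrix.conjTranspose_apply, add_comm]
  hasSum x y hx hy := by
    have h1 := h.hasSum (star y) (star x) (by rwa [norm_star]) (by rwa [norm_star])
    rw [← (Equiv.prodComm _ _).hasSum_iff]
    refine ((Complex.hasSum_conj').2 (by simpa using h1)).congr_fun fun m => ?_
    simp [Matrix.conjTranspose_apply, monomial_star]
    ring

theorem HasExp.isHermitian {n : ℕ} {b : Matrix (Fin n → ℕ) (Fin n → ℕ) ℂ} {r : ℝ}
    {F : (Fin n → ℂ) → (Fin n → ℂ) → ℂ} (h : HasExp b r F) (hr : 0 < r)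
    (hF : ∀ᶠ x in 𝓝 (0 : Fin n → ℂ), conj (F x (star x)) = F x (star x)) : b.IsHermitian :=
  h.conj_swap.unique h hr hr (by simpa using hF)

/-- Reality on the antidiagonal makes the coefficients Hermitian, and this spreads the symmetry to
the whole polydisc. -/
theorem HasExp.conj_apply {n : ℕ} {b : Matrix (Fin n → ℕ) (Fin n → ℕ) ℂ} {r : ℝ}
    {F : (Fin n → ℂ) → (Fin n → ℂ) → ℂ} (h : HasExp b r F) (hr : 0 < r)
    (hF : ∀ᶠ x in 𝓝 (0 : Fin n → ℂ), conj (F x (star x)) = F x (star x)) {x y : Fin n → ℂ}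
    (hx : ‖x‖ ≤ r) (hy : ‖y‖ ≤ r) : conj (F x y) = F (star y) (star x) := by
  have h1 := h.conj_swap.hasSum (star y) (star x) (by rwa [norm_star]) (by rwa [norm_star])
  rw [(h.isHermitian hr hF : _ = _)] at h1
  simpa using h1.unique (h.hasSum (star y) (star x) (by rwa [norm_star]) (by rwa [norm_star]))

/-- A holomorphic function which vanishes on the antidiagonal vanishes. -/
theorem eventually_eq_zero_of_antidiagonal {n : ℕ} {F : (Fin n → ℂ) × (Fin n → ℂ) → ℂ}
    {p : Fin n → ℂ} (hF : AnalyticAt ℂ F (p, star p))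
    (h : ∀ᶠ z in 𝓝 p, F (z, star z) = 0) : ∀ᶠ q in 𝓝 (p, star p), F q = 0 := by
  obtain ⟨r, hr, b, hb⟩ := exists_hasExp hF
  have hb0 : b = 0 := by
    refine eq_zero_of_hasSum_star ?_
    have h1 : ∀ᶠ x in 𝓝 (0 : Fin n → ℂ), F (p + x, star (p + x)) = 0 := by
      have : Filter.Tendsto (fun x => p + x) (𝓝 0) (𝓝 p) := by
        simpa using (continuous_const_add p).tendsto 0
      exact this.eventually h
    filter_upwards [hb.eventually_hasSum hr, h1] with x hx hx1
    simpa [star_add, ← hx1] using hx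
  filter_upwards [Metric.ball_mem_nhds _ hr] with q hq
  have hq' : ‖q.1 - p‖ ≤ r ∧ ‖q.2 - star p‖ ≤ r := by
    rw [mem_ball_iff_norm, Prod.norm_def, max_lt_iff] at hq
    exact ⟨hq.1.le, hq.2.le⟩
  have := hb.hasSum _ _ hq'.1 hq'.2
  simp only [hb0, Matrix.zero_apply, zero_mul, add_sub_cancel] at this
  exact this.unique hasSum_zero

/-! ### Wirtinger derivatives of restrictions to the antidiagonal -/

lemma hasFDerivAt_antidiagonal {n : ℕ} {F : (Fin n → ℂ) × (Fin n → ℂ) → ℂ} {z : Fin n → ℂ}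
    (hF : DifferentiableAt ℂ F (z, star z)) (v : Fin n → ℂ) :
    fderiv ℝ (fun x => F (x, star x)) z v = fderiv ℂ F (z, star z) (v, star v) := by
  have h1 : HasFDerivAt (fun x : Fin n → ℂ => (x, star x))
      ((ContinuousLinearMap.id ℝ (Fin n → ℂ)).prod
        ((starL' ℝ : (Fin n → ℂ) ≃L[ℝ] (Fin n → ℂ)) : (Fin n → ℂ) →L[ℝ] (Fin n → ℂ))) z :=
    (hasFDerivAt_id z).prodMk
      ((starL' ℝ : (Fin n → ℂ) ≃L[ℝ] (Fin n → ℂ)) : (Fin n → ℂ) →L[ℝ] (Fin n → ℂ)).hasFDerivAt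
  have h2 := (hF.hasFDerivAt.restrictScalars ℝ).comp z h1
  have h3 : HasFDerivAt (fun x => F (x, star x)) _ z := h2
  rw [h3.fderiv]
  rfl

lemma star_single_one {n : ℕ} (k : Fin n) :
    star (Pi.single k 1 : Fin n → ℂ) = Pi.single k 1 := by
  ext i; by_cases h : i = k
  · subst h; simp
  · simp [h]

lemma single_I {n : ℕ} (k : Fin n) :
    (Pi.single k Complex.I : Fin n → ℂ) = Complex.I • Pi.single k 1 := by
  ext i; by_cases h : i = k
  · subst h; simp
  · simp [h]

/-- The tangent vector in direction `i e_k` is `i (e_k, 0) - i (0, e_k)`, so the Wirtinger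
combination cancels the derivative in the first slot. -/
lemma dzbar_antidiagonal {n : ℕ} {F : (Fin n → ℂ) × (Fin n → ℂ) → ℂ} {z : Fin n → ℂ}
    (hF : DifferentiableAt ℂ F (z, star z)) (k : Fin n) :
    dzbar k (fun x => F (x, star x)) z = fderiv ℂ F (z, star z) (0, Pi.single k 1) := by
  have h1 : ((Pi.single k Complex.I : Fin n → ℂ), star (Pi.single k Complex.I : Fin n → ℂ)) =
      Complex.I • ((Pi.single k 1 : Fin n → ℂ), (0 : Fin n → ℂ)) -
        Complex.I • ((0 : Fin n → ℂ), (Pi.single k 1 : Fin n → ℂ)) := by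
    rw [single_I, star_smul, star_single_one]; ext <;> simp
  have h2 : ((Pi.single k 1 : Fin n → ℂ), star (Pi.single k 1 : Fin n → ℂ)) =
      ((Pi.single k 1 : Fin n → ℂ), (0 : Fin n → ℂ)) +
        ((0 : Fin n → ℂ), (Pi.single k 1 : Fin n → ℂ)) := by
    rw [star_single_one]; ext <;> simp
  rw [dzbar, hasFDerivAt_antidiagonal hF, hasFDerivAt_antidiagonal hF, h1, h2, map_add, map_sub,
    map_smul, map_smul, smul_eq_mul, smul_eq_mul, mul_sub, ← mul_assoc, ← mul_assoc,
    Complex.I_mul_I]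
  ring

lemma dz_antidiagonal {n : ℕ} {F : (Fin n → ℂ) × (Fin n → ℂ) → ℂ} {z : Fin n → ℂ}
    (hF : DifferentiableAt ℂ F (z, star z)) (k : Fin n) :
    dz k (fun x => F (x, star x)) z = fderiv ℂ F (z, star z) (Pi.single k 1, 0) := by
  have h1 : ((Pi.single k Complex.I : Fin n → ℂ), star (Pi.single k Complex.I : Fin n → ℂ)) =
      Complex.I • ((Pi.single k 1 : Fin n → ℂ), (0 : Fin n → ℂ)) -
        Complex.I • ((0 : Fin n → ℂ), (Pi.single k 1 : Fin n → ℂ)) := by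
    rw [single_I, star_smul, star_single_one]; ext <;> simp
  have h2 : ((Pi.single k 1 : Fin n → ℂ), star (Pi.single k 1 : Fin n → ℂ)) =
      ((Pi.single k 1 : Fin n → ℂ), (0 : Fin n → ℂ)) +
        ((0 : Fin n → ℂ), (Pi.single k 1 : Fin n → ℂ)) := by
    rw [star_single_one]; ext <;> simp
  rw [dz, hasFDerivAt_antidiagonal hF, hasFDerivAt_antidiagonal hF, h1, h2, map_add, map_sub,
    map_smul, map_smul, smul_eq_mul, smul_eq_mul, mul_sub, ← mul_assoc, ← mul_assoc,
    Complex.I_mul_I]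
  ring

lemma tendsto_antidiagonal {n : ℕ} (z : Fin n → ℂ) :
    Filter.Tendsto (fun x : Fin n → ℂ => (x, star x)) (𝓝 z) (𝓝 (z, star z)) :=
  (continuous_id.prodMk continuous_star).tendsto z

lemma dz_congr {n : ℕ} {f f' : (Fin n → ℂ) → ℂ} {z : Fin n → ℂ} (h : f =ᶠ[𝓝 z] f')
    (k : Fin n) : dz k f z = dz k f' z := by
  rw [dz, dz, h.fderiv_eq]

lemma dzbar_congr {n : ℕ} {f f' : (Fin n → ℂ) → ℂ} {z : Fin n → ℂ} (h : f =ᶠ[𝓝 z] f')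
    (k : Fin n) : dzbar k f z = dzbar k f' z := by
  rw [dzbar, dzbar, h.fderiv_eq]

/-- The mixed second derivatives of the polarization of a potential are the metric. -/
theorem metricOfPotential_eq {n : ℕ} {F : (Fin n → ℂ) × (Fin n → ℂ) → ℂ} {z : Fin n → ℂ}
    {Φ : (Fin n → ℂ) → ℝ} (hF : AnalyticAt ℂ F (z, star z))
    (hΦ : ∀ᶠ x in 𝓝 z, F (x, star x) = Φ x) (j k : Fin n) :
    metricOfPotential Φ z j k =
      fderiv ℂ (fun q => fderiv ℂ F q (0, Pi.single k 1)) (z, star z) (Pi.single j 1, 0) := by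
  have hF' : AnalyticAt ℂ (fun q => fderiv ℂ F q (0, Pi.single k 1)) (z, star z) :=
    ((ContinuousLinearMap.apply ℂ ℂ ((0 : Fin n → ℂ), (Pi.single k 1 : Fin n → ℂ))).analyticAt
      _).comp hF.fderiv
  rw [← dz_antidiagonal hF'.differentiableAt]
  refine dz_congr ?_ j
  filter_upwards [hΦ.eventually_nhds,
    (tendsto_antidiagonal z).eventually hF.eventually_analyticAt] with x hx hx'
  rw [← dzbar_antidiagonal hx'.differentiableAt]
  exact dzbar_congr (hx.mono fun y hy => hy.symm) k

/-! ### Uniqueness of the diastasis -/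

lemma eq_of_partial_eq_zero {n : ℕ} {f : (Fin n → ℂ) → ℂ} {p x : Fin n → ℂ} {ε : ℝ}
    (hf : ∀ y ∈ Metric.ball p ε, DifferentiableAt ℂ f y)
    (h0 : ∀ y ∈ Metric.ball p ε, ∀ j, fderiv ℂ f y (Pi.single j 1) = 0)
    (hx : x ∈ Metric.ball p ε) : f x = f p := by
  refine Metric.isOpen_ball.is_const_of_fderiv_eq_zero (𝕜 := ℂ)
    (convex_ball p ε).isPreconnected
    (fun y hy => (hf y hy).differentiableWithinAt) (fun y hy => ?_) hx
    (Metric.mem_ball_self (Metric.pos_of_mem_ball hx))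
  refine ContinuousLinearMap.coe_injective ((Pi.basisFun ℂ (Fin n)).ext fun j => ?_)
  simpa using h0 y hy j

/-- The mixed derivatives are holomorphic, so their vanishing spreads from the antidiagonal to a
neighbourhood. There `H` is a function of the first variable plus a function of the second, and the
diastasis combination annihilates such sums. -/
theorem eventually_eq_of_mixed_eq_zero {n : ℕ} {H : (Fin n → ℂ) × (Fin n → ℂ) → ℂ}
    {p : Fin n → ℂ} (hH : AnalyticAt ℂ H (p, star p))
    (h : ∀ j k, ∀ᶠ z in 𝓝 p,
      fderiv ℂ (fun q => fderiv ℂ H q (0, Pi.single k 1)) (z, star z) (Pi.single j 1, 0) = 0) :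
    ∀ᶠ q in 𝓝 (p, star p), H q + H (p, star p) - H (q.1, star p) - H (p, q.2) = 0 := by
  have hk : ∀ k : Fin n, ∀ q, AnalyticAt ℂ H q →
      AnalyticAt ℂ (fun q => fderiv ℂ H q (0, Pi.single k 1)) q := fun k q hq =>
    ((ContinuousLinearMap.apply ℂ ℂ ((0 : Fin n → ℂ), (Pi.single k 1 : Fin n → ℂ))).analyticAt
      _).comp hq.fderiv
  have h1 : ∀ᶠ q in 𝓝 (p, star p), AnalyticAt ℂ H q ∧ ∀ j k : Fin n,
      fderiv ℂ (fun q => fderiv ℂ H q (0, Pi.single k 1)) q (Pi.single j 1, 0) = 0 := by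
    refine hH.eventually_analyticAt.and (Filter.eventually_all.2 fun j =>
      Filter.eventually_all.2 fun k => ?_)
    refine eventually_eq_zero_of_antidiagonal (F := fun q =>
      fderiv ℂ (fun q => fderiv ℂ H q (0, Pi.single k 1)) q (Pi.single j 1, 0)) ?_ (h j k)
    exact ((ContinuousLinearMap.apply ℂ ℂ
      ((Pi.single j 1 : Fin n → ℂ), (0 : Fin n → ℂ))).analyticAt _).comp (hk k _ hH).fderiv
  obtain ⟨ε, hε, hball⟩ := Metric.eventually_nhds_iff_ball.1 h1
  rw [← ball_prod_same] at hball
  have hp : p ∈ Metric.ball p ε := Metric.mem_ball_self hε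
  have hp' : star p ∈ Metric.ball (star p) ε := Metric.mem_ball_self hε
  have hfst : ∀ z η : Fin n → ℂ, HasFDerivAt (fun x : Fin n → ℂ => (x, η))
      (ContinuousLinearMap.inl ℂ (Fin n → ℂ) (Fin n → ℂ)) z := fun z η => hasFDerivAt_prodMk_left z η
  have hsnd : ∀ z η : Fin n → ℂ, HasFDerivAt (fun y : Fin n → ℂ => (z, y))
      (ContinuousLinearMap.inr ℂ (Fin n → ℂ) (Fin n → ℂ)) η := fun z η =>
    hasFDerivAt_prodMk_right z η
  -- Integrating in the first variable: the derivatives of `H` in the second variable do not depend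
  -- on the first.
  have hstep : ∀ z ∈ Metric.ball p ε, ∀ η ∈ Metric.ball (star p) ε, ∀ k : Fin n,
      fderiv ℂ H (z, η) (0, Pi.single k 1) = fderiv ℂ H (p, η) (0, Pi.single k 1) := by
    intro z hz η hη k
    have hd : ∀ y ∈ Metric.ball p ε, HasFDerivAt
        (fun x => fderiv ℂ H (x, η) (0, Pi.single k 1))
        ((fderiv ℂ (fun q => fderiv ℂ H q (0, Pi.single k 1)) (y, η)).comp
          (ContinuousLinearMap.inl ℂ _ _)) y := fun y hy =>
      HasFDerivAt.comp (g := fun q => fderiv ℂ H q (0, Pi.single k 1)) y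
        (hk k _ (hball (y, η) ⟨hy, hη⟩).1).differentiableAt.hasFDerivAt (hfst y η)
    refine eq_of_partial_eq_zero (f := fun x => fderiv ℂ H (x, η) (0, Pi.single k 1))
      (fun y hy => (hd y hy).differentiableAt) (fun y hy j => ?_) hz
    rw [(hd y hy).fderiv]
    exact (hball (y, η) ⟨hy, hη⟩).2 j k
  filter_upwards [prod_mem_nhds (Metric.ball_mem_nhds p hε)
    (Metric.ball_mem_nhds (star p) hε)] with q hq
  -- Integrating in the second variable: this difference is constant in `η`.
  have hd : ∀ y ∈ Metric.ball (star p) ε, HasFDerivAt (fun η => H (q.1, η) - H (p, η))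
      ((fderiv ℂ H (q.1, y)).comp (ContinuousLinearMap.inr ℂ _ _) -
        (fderiv ℂ H (p, y)).comp (ContinuousLinearMap.inr ℂ _ _)) y := fun y hy =>
    ((hball (q.1, y) ⟨hq.1, hy⟩).1.differentiableAt.hasFDerivAt.comp y (hsnd q.1 y)).sub
      ((hball (p, y) ⟨hp, hy⟩).1.differentiableAt.hasFDerivAt.comp y (hsnd p y))
  have := eq_of_partial_eq_zero (f := fun η => H (q.1, η) - H (p, η))
    (fun y hy => (hd y hy).differentiableAt) (fun y hy j => by
      rw [(hd y hy).fderiv]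
      exact sub_eq_zero.2 (hstep q.1 hq.1 y hy j)) hq.2
  linear_combination this

/-- The polarized diastasis centred at `p` of a polarized potential. -/
def polarDiastasis {n : ℕ} (Ψ : (Fin n → ℂ) × (Fin n → ℂ) → ℂ) (p : Fin n → ℂ)
    (q : (Fin n → ℂ) × (Fin n → ℂ)) : ℂ :=
  Ψ q + Ψ (p, star p) - Ψ (q.1, star p) - Ψ (p, q.2)

lemma analyticAt_polarDiastasis {n : ℕ} {Ψ : (Fin n → ℂ) × (Fin n → ℂ) → ℂ} {p : Fin n → ℂ}
    (hΨ : AnalyticAt ℂ Ψ (p, star p)) : AnalyticAt ℂ (polarDiastasis Ψ p) (p, star p) := by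
  have h1 : AnalyticAt ℂ (fun q : (Fin n → ℂ) × (Fin n → ℂ) => Ψ (q.1, star p)) (p, star p) :=
    AnalyticAt.fun_comp (g := Ψ) (f := fun q : (Fin n → ℂ) × (Fin n → ℂ) => (q.1, star p)) hΨ
      (analyticAt_fst.prod analyticAt_const)
  have h2 : AnalyticAt ℂ (fun q : (Fin n → ℂ) × (Fin n → ℂ) => Ψ (p, q.2)) (p, star p) :=
    AnalyticAt.fun_comp (g := Ψ) (f := fun q : (Fin n → ℂ) × (Fin n → ℂ) => (p, q.2)) hΨ
      (analyticAt_const.prod analyticAt_snd)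
  exact ((hΨ.add analyticAt_const).sub h1).sub h2

/-- The diastasis does not depend on the choice of the potential. -/
theorem IsDiastasisAt.eventually_eq {n : ℕ} {g : (Fin n → ℂ) → Matrix (Fin n) (Fin n) ℂ}
    {p : Fin n → ℂ} {D Φ : (Fin n → ℂ) → ℝ} {Ψ : (Fin n → ℂ) × (Fin n → ℂ) → ℂ}
    (hD : IsDiastasisAt g p D) (hΨ : AnalyticAt ℂ Ψ (p, star p))
    (hΦ : ∀ᶠ z in 𝓝 p, Ψ (z, star z) = Φ z) (hg : ∀ᶠ z in 𝓝 p, metricOfPotential Φ z = g z) :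
    ∀ᶠ z in 𝓝 p, (D z : ℂ) = polarDiastasis Ψ p (z, star z) := by
  obtain ⟨U, Φ', G, hU, hpU, hmet, hG, hGΦ, hDG⟩ := hD
  set F : (Fin n → ℂ) × (Fin n → ℂ) → ℂ := fun x => G x.1 (star x.2) with hF
  have hFan : ∀ z ∈ U, AnalyticAt ℂ F (z, star z) := fun z hz => hG (z, star z) ⟨hz, by simpa⟩
  have hFs : ∀ z w, F (z, star w) = G z w := fun z w => by simp [hF]
  -- Both potentials have metric `g`, so the difference of their polarizations has no mixed
  -- derivatives on the antidiagonal.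
  have hH : ∀ j k, ∀ᶠ z in 𝓝 p,
      fderiv ℂ (fun q => fderiv ℂ (F - Ψ) q (0, Pi.single k 1)) (z, star z)
        (Pi.single j 1, 0) = 0 := by
    intro j k
    filter_upwards [hU.mem_nhds hpU, hΦ.eventually_nhds, hg,
      (tendsto_antidiagonal p).eventually hΨ.eventually_analyticAt] with z hzU hzΦ hzg hzΨ
    have h1 := metricOfPotential_eq (hFan z hzU) (Φ := Φ')
      (by filter_upwards [hU.mem_nhds hzU] with x hx; rw [hFs, hGΦ x hx]) j k
    have h2 := metricOfPotential_eq hzΨ hzΦ j k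
    rw [hmet z hzU, ← hzg, h2] at h1
    have hsub : (fun q => fderiv ℂ (F - Ψ) q (0, Pi.single k 1)) =ᶠ[𝓝 (z, star z)]
        fun q => fderiv ℂ F q (0, Pi.single k 1) - fderiv ℂ Ψ q (0, Pi.single k 1) := by
      filter_upwards [(hFan z hzU).eventually_analyticAt, hzΨ.eventually_analyticAt] with q h3 h4
      rw [fderiv_sub h3.differentiableAt h4.differentiableAt]; rfl
    have hk : ∀ K : (Fin n → ℂ) × (Fin n → ℂ) → ℂ, AnalyticAt ℂ K (z, star z) →
        DifferentiableAt ℂ (fun q => fderiv ℂ K q (0, Pi.single k 1)) (z, star z) := fun K hK =>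
      (((ContinuousLinearMap.apply ℂ ℂ ((0 : Fin n → ℂ), (Pi.single k 1 : Fin n → ℂ))).analyticAt
        _).comp hK.fderiv).differentiableAt
    rw [hsub.fderiv_eq, fderiv_fun_sub (hk F (hFan z hzU)) (hk Ψ hzΨ)]
    exact sub_eq_zero.2 h1.symm
  have := (tendsto_antidiagonal p).eventually
    (eventually_eq_of_mixed_eq_zero ((hFan p hpU).sub hΨ) hH)
  filter_upwards [this, hU.mem_nhds hpU] with z hz hzU
  rw [hDG z hzU, polarDiastasis]
  simp only [Pi.sub_apply, hFs] at hz
  linear_combination hz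

/-- A potential with polarization `Ψ` gives a diastasis. -/
theorem isDiastasisAt_of_polarization {n : ℕ} {g : (Fin n → ℂ) → Matrix (Fin n) (Fin n) ℂ}
    {p : Fin n → ℂ} {D Φ : (Fin n → ℂ) → ℝ} {Ψ : (Fin n → ℂ) × (Fin n → ℂ) → ℂ}
    (hΨ : AnalyticAt ℂ Ψ (p, star p))
    (hΦ : ∀ᶠ z in 𝓝 p, Ψ (z, star z) = Φ z) (hg : ∀ᶠ z in 𝓝 p, metricOfPotential Φ z = g z)
    (hD : ∀ᶠ z in 𝓝 p, (D z : ℂ) = polarDiastasis Ψ p (z, star z)) : IsDiastasisAt g p D := by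
  obtain ⟨ε, hε, h1⟩ := Metric.eventually_nhds_iff_ball.1 (hΦ.and (hg.and hD))
  obtain ⟨δ, hδ, h2⟩ := Metric.eventually_nhds_iff_ball.1 hΨ.eventually_analyticAt
  have hle := ball_prod_same p (star p) δ
  refine ⟨Metric.ball p (min ε δ), Φ, fun z w => Ψ (z, star w), Metric.isOpen_ball,
    Metric.mem_ball_self (lt_min hε hδ), fun z hz => ?_, ?_, fun z hz => ?_, fun z hz => ?_⟩
  · exact (h1 z (Metric.ball_subset_ball (min_le_left _ _) hz)).2.1
  · rintro ⟨z, η⟩ ⟨hz, hη⟩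
    simp only [star_star]
    refine h2 (z, η) ?_
    rw [← hle]
    refine ⟨Metric.ball_subset_ball (min_le_right _ _) hz, ?_⟩
    have := Metric.ball_subset_ball (min_le_right _ _) hη
    rw [mem_ball_iff_norm] at this ⊢
    rwa [← norm_star, star_sub, star_star]
  · exact (h1 z (Metric.ball_subset_ball (min_le_left _ _) hz)).1
  · exact (h1 z (Metric.ball_subset_ball (min_le_left _ _) hz)).2.2

/-! ### Products of expansions -/

/-- The pairs of multi-indices below a given one. -/
def lower {n : ℕ} (m : (Fin n → ℕ) × (Fin n → ℕ)) : Finset ((Fin n → ℕ) × (Fin n → ℕ)) :=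
  Finset.Iic m.1 ×ˢ Finset.Iic m.2

lemma mem_lower {n : ℕ} {m v : (Fin n → ℕ) × (Fin n → ℕ)} :
    v ∈ lower m ↔ v.1 ≤ m.1 ∧ v.2 ≤ m.2 := by
  simp [lower]

/-- The equivalence behind the Cauchy product of expansions. -/
def cauchyEquiv (n : ℕ) : (Σ m : (Fin n → ℕ) × (Fin n → ℕ), {v // v ∈ lower m}) ≃
    ((Fin n → ℕ) × (Fin n → ℕ)) × ((Fin n → ℕ) × (Fin n → ℕ)) where
  toFun s := ((s.1.1 - s.2.1.1, s.1.2 - s.2.1.2), s.2.1)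
  invFun p := ⟨p.1 + p.2, p.2, mem_lower.2 ⟨le_add_self, le_add_self⟩⟩
  left_inv := by
    rintro ⟨m, v, hv⟩
    have hv' := mem_lower.1 hv
    have h1 : (m.1 - v.1, m.2 - v.2) + v = m :=
      Prod.ext (tsub_add_cancel_of_le hv'.1) (tsub_add_cancel_of_le hv'.2)
    refine Sigma.ext h1 ?_
    refine (Subtype.heq_iff_coe_eq fun x => ?_).2 rfl
    simp only [h1]
  right_inv := by
    rintro ⟨u, v⟩
    simp

lemma hasSum_cauchy {R : Type*} [NormedCommRing R] [CompleteSpace R] {n : ℕ}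
    {f g : (Fin n → ℕ) × (Fin n → ℕ) → R} {A B : R} (hf : Summable fun m => ‖f m‖)
    (hg : Summable fun m => ‖g m‖) (hA : HasSum f A) (hB : HasSum g B) :
    HasSum (fun m => ∑ v ∈ lower m, f (m.1 - v.1, m.2 - v.2) * g v) (A * B) := by
  have h1 := hA.mul hB (summable_mul_of_summable_norm hf hg)
  rw [← (cauchyEquiv n).hasSum_iff] at h1
  refine h1.sigma fun m => ?_
  rw [← Finset.sum_coe_sort]
  exact hasSum_fintype _

/-- The coefficients of the product of two expansions. -/
def cauchyMul {n : ℕ} (a b : Matrix (Fin n → ℕ) (Fin n → ℕ) ℂ) :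
    Matrix (Fin n → ℕ) (Fin n → ℕ) ℂ :=
  fun α β => ∑ v ∈ lower (α, β), a (α - v.1) (β - v.2) * b v.1 v.2

/-- The majorant of an expansion. -/
def expNorm {n : ℕ} (b : Matrix (Fin n → ℕ) (Fin n → ℕ) ℂ) (r : ℝ) : ℝ :=
  ∑' m : (Fin n → ℕ) × (Fin n → ℕ), ‖b m.1 m.2‖ * r ^ (mdeg m.1 + mdeg m.2)

lemma expNorm_nonneg {n : ℕ} (b : Matrix (Fin n → ℕ) (Fin n → ℕ) ℂ) {r : ℝ} (hr : 0 ≤ r) :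
    0 ≤ expNorm b r := tsum_nonneg fun _ => by positivity

lemma norm_cauchyMul_le {n : ℕ} (a b : Matrix (Fin n → ℕ) (Fin n → ℕ) ℂ) {r : ℝ} (hr : 0 ≤ r)
    (m : (Fin n → ℕ) × (Fin n → ℕ)) :
    ‖cauchyMul a b m.1 m.2‖ * r ^ (mdeg m.1 + mdeg m.2) ≤ ∑ v ∈ lower m,
      (‖a (m.1 - v.1) (m.2 - v.2)‖ * r ^ (mdeg (m.1 - v.1) + mdeg (m.2 - v.2))) *
        (‖b v.1 v.2‖ * r ^ (mdeg v.1 + mdeg v.2)) := by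
  refine (mul_le_mul_of_nonneg_right (norm_sum_le _ _) (by positivity)).trans ?_
  rw [Finset.sum_mul]
  refine Finset.sum_le_sum fun v hv => le_of_eq ?_
  have hv' := mem_lower.1 hv
  have h1 : mdeg m.1 = mdeg (m.1 - v.1) + mdeg v.1 := by
    rw [← mdeg_add, tsub_add_cancel_of_le hv'.1]
  have h2 : mdeg m.2 = mdeg (m.2 - v.2) + mdeg v.2 := by
    rw [← mdeg_add, tsub_add_cancel_of_le hv'.2]
  rw [h1, h2, norm_mul]
  ring

/-- Submultiplicativity of the majorant is recorded because it bounds all powers of an expansion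
geometrically on one fixed polydisc. -/
theorem HasExp.mul {n : ℕ} {a b : Matrix (Fin n → ℕ) (Fin n → ℕ) ℂ} {r : ℝ}
    {F G : (Fin n → ℂ) → (Fin n → ℂ) → ℂ} (hF : HasExp a r F) (hG : HasExp b r G) (hr : 0 ≤ r) :
    HasExp (cauchyMul a b) r (fun x y => F x y * G x y) ∧
      expNorm (cauchyMul a b) r ≤ expNorm a r * expNorm b r := by
  have h1 := hasSum_cauchy (R := ℝ) (by simpa [abs_of_nonneg hr] using hF.summable)
    (by simpa [abs_of_nonneg hr] using hG.summable) hF.summable.hasSum hG.summable.hasSum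
  have h2 : Summable fun m : (Fin n → ℕ) × (Fin n → ℕ) =>
      ‖cauchyMul a b m.1 m.2‖ * r ^ (mdeg m.1 + mdeg m.2) :=
    h1.summable.of_nonneg_of_le (fun _ => by positivity) (norm_cauchyMul_le a b hr)
  refine ⟨⟨h2, fun x y hx hy => ?_⟩, ?_⟩
  · have h3 := hasSum_cauchy
      (hF.summable.of_nonneg_of_le (fun _ => norm_nonneg _) (norm_term_le a hx hy))
      (hG.summable.of_nonneg_of_le (fun _ => norm_nonneg _) (norm_term_le b hx hy))
      (hF.hasSum x y hx hy) (hG.hasSum x y hx hy)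
    refine h3.congr_fun fun m => ?_
    rw [cauchyMul, Finset.sum_mul, Finset.sum_mul]
    refine Finset.sum_congr rfl fun v hv => ?_
    have hv' := mem_lower.1 hv
    have h1 : monomial m.1 x = monomial (m.1 - v.1) x * monomial v.1 x := by
      rw [← monomial_add, tsub_add_cancel_of_le hv'.1]
    have h2 : monomial m.2 y = monomial (m.2 - v.2) y * monomial v.2 y := by
      rw [← monomial_add, tsub_add_cancel_of_le hv'.2]
    rw [h1, h2]
    ring
  · rw [expNorm, expNorm, expNorm, ← h1.tsum_eq]
    exact h2.tsum_le_tsum (norm_cauchyMul_le a b hr) h1.summable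

/-! ### Positive semidefinite matrices of coefficients -/

/-- The map `e` may repeat indices; this is what the applications to products and to fibres need. -/
lemma posSemidef_sum_nonneg {ι κ : Type*} {M : Matrix ι ι ℂ} (hM : M.PosSemidef) (t : Finset κ)
    (e : κ → ι) (x : κ → ℂ) :
    0 ≤ ∑ k ∈ t, ∑ l ∈ t, conj (x k) * M (e k) (e l) * x l := by
  have h := (hM.submatrix fun k : t => e k).2 (Finsupp.equivFunOnFinite.symm fun k : t => x k)
  rw [Finsupp.sum_fintype _ _ (by simp)] at h
  rw [← Finset.sum_coe_sort]
  refine h.trans_eq (Finset.sum_congr rfl fun k _ => ?_)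
  rw [Finsupp.sum_fintype _ _ (by simp), ← Finset.sum_coe_sort t]
  rfl

lemma posSemidef_of_sum_nonneg {ι : Type*} {M : Matrix ι ι ℂ} (hM : M.IsHermitian)
    (h : ∀ (s : Finset ι) (x : ι → ℂ), 0 ≤ ∑ k ∈ s, ∑ l ∈ s, conj (x k) * M k l * x l) :
    M.PosSemidef :=
  ⟨hM, fun x => h x.support x⟩

/-- Multiplication by `f(x) conj f(x)` turns `b` into `T b T^*`, where `T` is the matrix of
multiplication by `f`. Its rows are finite, so the quadratic form at a finitely supported `x` is the
form of `b` at a finitely supported vector. -/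
theorem posSemidef_cauchyMul {n : ℕ} (u : (Fin n → ℕ) → ℂ)
    {b : Matrix (Fin n → ℕ) (Fin n → ℕ) ℂ} (hb : b.PosSemidef) :
    (cauchyMul (fun α β => u α * conj (u β)) b).PosSemidef := by
  have hc : ∀ α β, cauchyMul (fun α β => u α * conj (u β)) b α β =
      ∑ v ∈ Finset.Iic α, ∑ w ∈ Finset.Iic β, u (α - v) * b v w * conj (u (β - w)) := by
    intro α β
    change ∑ v ∈ lower (α, β), u (α - v.1) * conj (u (β - v.2)) * b v.1 v.2 = _
    rw [lower, Finset.sum_product]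
    refine Finset.sum_congr rfl fun v _ => Finset.sum_congr rfl fun w _ => ?_
    ring
  refine posSemidef_of_sum_nonneg ?_ fun s x => ?_
  · ext α β
    rw [Matrix.conjTranspose_apply, hc, hc, Finset.sum_comm, star_sum]
    refine Finset.sum_congr rfl fun v _ => ?_
    rw [star_sum]
    refine Finset.sum_congr rfl fun w _ => ?_
    have := hb.1.apply v w
    simp only [star_mul', RCLike.star_def, Complex.conj_conj] at this ⊢
    rw [this]
    ring
  -- This is `T^* x` before the contributions to the same index of `b` are collected.
  · have := posSemidef_sum_nonneg hb (s.sigma fun α => Finset.Iic α) (fun k => k.2)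
      (fun k => conj (u (k.1 - k.2)) * x k.1)
    simp only [Finset.sum_sigma] at this
    refine this.trans_eq (Finset.sum_congr rfl fun α _ => ?_)
    rw [Finset.sum_comm]
    refine Finset.sum_congr rfl fun β _ => ?_
    rw [hc, Finset.mul_sum, Finset.sum_mul]
    refine Finset.sum_congr rfl fun v _ => ?_
    rw [Finset.mul_sum, Finset.sum_mul]
    refine Finset.sum_congr rfl fun w _ => ?_
    simp only [map_mul, Complex.conj_conj]
    ring

lemma posSemidef_single {ι : Type*} [DecidableEq ι] (i : ι) :
    (Matrix.single i i (1 : ℂ)).PosSemidef := by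
  refine posSemidef_of_sum_nonneg ?_ fun s x => ?_
  · simp [Matrix.IsHermitian]
  · have : ∑ k ∈ s, ∑ l ∈ s, conj (x k) * Matrix.single i i (1 : ℂ) k l * x l =
        ∑ k ∈ s, ∑ l ∈ s, conj (if i = k then x k else 0) * (if i = l then x l else 0) := by
      refine Finset.sum_congr rfl fun k _ => Finset.sum_congr rfl fun l _ => ?_
      rw [Matrix.single_apply]
      split_ifs <;> simp_all
    rw [this]
    simp only [← Finset.mul_sum, ← Finset.sum_mul, ← map_sum]
    rw [mul_comm]
    exact Complex.mul_conj _ ▸ by exact_mod_cast Complex.normSq_nonneg _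

/-- The index `i` is decoupled from the others and carries the block `1`. Removing that block
amounts to testing `b` on vectors whose entry at `i` is zero. -/
theorem posSemidef_sub_single_iff {ι : Type*} [DecidableEq ι] {b : Matrix ι ι ℂ} {i : ι}
    (h1 : ∀ j, b i j = if j = i then 1 else 0) (h2 : ∀ j, b j i = if j = i then 1 else 0) :
    (b - Matrix.single i i 1).PosSemidef ↔ b.PosSemidef := by
  refine ⟨fun h => by simpa using h.add (posSemidef_single i), fun h => ?_⟩
  refine posSemidef_of_sum_nonneg (h.1.sub (posSemidef_single i).1) fun s x => ?_
  refine (posSemidef_sum_nonneg h s id (Function.update x i 0)).trans_eq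
    (Finset.sum_congr rfl fun k _ => Finset.sum_congr rfl fun l _ => ?_)
  by_cases hk : k = i
  · subst hk
    by_cases hl : l = k
    · subst hl; simp [h1]
    · simp [h1, hl, Ne.symm hl]
  · by_cases hl : l = i
    · subst hl; simp [h2, hk, Ne.symm hk]
    · simp [hk, hl, Ne.symm hk]

/-! ### Resolvability through the exponential of a potential -/

lemma eventually_nhds_iff_add {n : ℕ} {p : Fin n → ℂ} {P : (Fin n → ℂ) → Prop} :
    (∀ᶠ z in 𝓝 p, P z) ↔ ∀ᶠ x in 𝓝 0, P (p + x) := by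
  rw [← map_add_left_nhds_zero p, Filter.eventually_map]

lemma monomial_apply_zero {n : ℕ} (α : Fin n → ℕ) :
    monomial α (0 : Fin n → ℂ) = if α = 0 then 1 else 0 := by
  split_ifs with h
  · rw [h, monomial_zero]
  · obtain ⟨i, hi⟩ := Function.ne_iff.1 h
    exact Finset.prod_eq_zero (Finset.mem_univ i) (by simpa using hi)

lemma HasExp.restrict {n : ℕ} {b : Matrix (Fin n → ℕ) (Fin n → ℕ) ℂ} {r : ℝ}
    {F : (Fin n → ℂ) → (Fin n → ℂ) → ℂ} (h : HasExp b r F) (hr : 0 ≤ r) :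
    HasExp (fun α β => if α = 0 then b α β else 0) r (fun _ y => F 0 y) where
  summable := h.summable.of_nonneg_of_le (fun _ => by positivity) fun m => by
    by_cases hm : m.1 = 0
    · simp [hm]
    · simp only [hm, if_false, norm_zero, zero_mul]; positivity
  hasSum x y hx hy := by
    refine (h.hasSum 0 y (by simpa) hy).congr_fun fun m => ?_
    by_cases hm : m.1 = 0
    · simp [hm, monomial_zero]
    · simp [hm, monomial_apply_zero]

lemma hasExp_one {n : ℕ} (r : ℝ) :
    HasExp (Matrix.single 0 0 (1 : ℂ)) r (fun _ _ : Fin n → ℂ => 1) := by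
  have h : ∀ m : (Fin n → ℕ) × (Fin n → ℕ), m ≠ (0, 0) →
      Matrix.single 0 0 (1 : ℂ) m.1 m.2 = 0 := fun m hm => by
    rw [Matrix.single_apply, if_neg]
    rintro ⟨h1, h2⟩
    exact hm (Prod.ext h1.symm h2.symm)
  refine ⟨summable_of_ne_finset_zero (s := {(0, 0)}) fun m hm => ?_, fun x y _ _ => ?_⟩
  · rw [h m (by simpa using hm)]; simp
  · have := hasSum_ite_eq ((0, 0) : (Fin n → ℕ) × (Fin n → ℕ)) (1 : ℂ)
    refine this.congr_fun fun m => ?_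
    split_ifs with hm
    · simp [hm, monomial_zero]
    · simp [h m hm]

lemma exists_hasExp_mul_conj {n : ℕ} {f : (Fin n → ℂ) → ℂ} (hf : AnalyticAt ℂ f 0) :
    ∃ r > 0, ∃ u : (Fin n → ℕ) → ℂ,
      HasExp (fun α β => u α * conj (u β)) r (fun x y => f x * conj (f (star y))) := by
  -- The two-variable expansion with first variable set to `0` supplies the expansion of `f` itself,
  -- through the row `a 0`.
  have hf' : AnalyticAt ℂ (fun q : (Fin n → ℂ) × (Fin n → ℂ) => f q.2)
      ((0 : Fin n → ℂ), (0 : Fin n → ℂ)) :=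
    AnalyticAt.fun_comp (g := f) (f := fun q : (Fin n → ℂ) × (Fin n → ℂ) => q.2) hf analyticAt_snd
  obtain ⟨r, hr, a, ha⟩ := exists_hasExp hf'
  have hinj : Function.Injective fun β : Fin n → ℕ => ((0 : Fin n → ℕ), β) :=
    fun _ _ h => (Prod.ext_iff.1 h).2
  have hs : Summable fun β : Fin n → ℕ => ‖a 0 β‖ * r ^ mdeg β := by
    refine (ha.summable.comp_injective hinj).congr fun β => ?_
    simp [mdeg_zero]
  have hsum : ∀ x : Fin n → ℂ, ‖x‖ ≤ r → HasSum (fun β => a 0 β * monomial β x) (f x) := by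
    intro x hx
    have h1 := ha.hasSum 0 x (by simpa using hr.le) hx
    rw [← hinj.hasSum_iff] at h1
    · simp only [zero_add] at h1
      refine h1.congr_fun fun β => ?_
      simp [monomial_zero]
    · rintro ⟨α, β⟩ h
      rw [monomial_apply_zero, if_neg, mul_zero, zero_mul]
      rintro rfl
      exact h ⟨β, rfl⟩
  have hsn : ∀ x : Fin n → ℂ, ‖x‖ ≤ r → Summable fun β => ‖a 0 β * monomial β x‖ :=
    fun x hx => hs.of_nonneg_of_le (fun _ => norm_nonneg _) fun β => by
      rw [norm_mul]; gcongr; exact norm_monomial_le β hx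
  refine ⟨r, hr, a 0, ?_, fun x y hx hy => ?_⟩
  · have h0 : ∀ β, 0 ≤ ‖a 0 β‖ * r ^ mdeg β := fun β => by positivity
    have h1 : Summable fun m : (Fin n → ℕ) × (Fin n → ℕ) =>
        ‖a 0 m.1‖ * r ^ mdeg m.1 * (‖a 0 m.2‖ * r ^ mdeg m.2) :=
      Summable.mul_of_nonneg (f := fun β => ‖a 0 β‖ * r ^ mdeg β)
        (g := fun β => ‖a 0 β‖ * r ^ mdeg β) hs hs h0 h0
    refine h1.congr fun m => ?_
    rw [norm_mul, RCLike.norm_conj, pow_add]; ring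
  · have hy' : ‖star y‖ ≤ r := by rwa [norm_star]
    have h2 : HasSum (fun β => conj (a 0 β * monomial β (star y))) (conj (f (star y))) :=
      Complex.hasSum_conj'.2 (hsum _ hy')
    have h3 : Summable fun β => ‖conj (a 0 β * monomial β (star y))‖ := by
      simpa only [RCLike.norm_conj] using hsn _ hy'
    have h4 : Summable fun m : (Fin n → ℕ) × (Fin n → ℕ) =>
        a 0 m.1 * monomial m.1 x * conj (a 0 m.2 * monomial m.2 (star y)) :=
      summable_mul_of_summable_norm (f := fun β => a 0 β * monomial β x)
        (g := fun β => conj (a 0 β * monomial β (star y))) (hsn x hx) h3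
    have h5 := HasSum.mul (f := fun β => a 0 β * monomial β x)
      (g := fun β => conj (a 0 β * monomial β (star y))) (hsum x hx) h2 h4
    refine h5.congr_fun fun m => ?_
    rw [monomial_star, map_mul, Complex.conj_conj]; ring

lemma posSemidef_of_mul_conj {n : ℕ} {b b' : Matrix (Fin n → ℕ) (Fin n → ℕ) ℂ} {r r' : ℝ}
    {F F' : (Fin n → ℂ) → (Fin n → ℂ) → ℂ} {f : (Fin n → ℂ) → ℂ} (hr : 0 < r) (hr' : 0 < r')
    (hb : HasExp b r F) (hb' : HasExp b' r' F') (hf : AnalyticAt ℂ f 0)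
    (h : ∀ᶠ x in 𝓝 0, F' x (star x) = f x * conj (f x) * F x (star x)) (hpos : b.PosSemidef) :
    b'.PosSemidef := by
  obtain ⟨ρ, hρ, u, hu⟩ := exists_hasExp_mul_conj hf
  have h1 := ((hu.mono (lt_min hρ hr).le (min_le_left _ _)).mul
    (hb.mono (lt_min hρ hr).le (min_le_right _ _)) (lt_min hρ hr).le).1
  rw [hb'.unique h1 hr' (lt_min hρ hr) (by simpa using h)]
  exact posSemidef_cauchyMul u hpos

section resolvability

variable {n : ℕ} {p : Fin n → ℂ} {Φ : (Fin n → ℂ) → ℝ} {Ψ : (Fin n → ℂ) × (Fin n → ℂ) → ℂ}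

/-- The potential is real, so its polarization is Hermitian symmetric; this is that symmetry with
one argument fixed at the centre. -/
lemma conj_polarization (hΨ : AnalyticAt ℂ Ψ (p, star p))
    (hΦ : ∀ᶠ z in 𝓝 p, Ψ (z, star z) = Φ z) :
    ∀ᶠ x in 𝓝 0, conj (Ψ (p + x, star p)) = Ψ (p, star (p + x)) := by
  obtain ⟨r, hr, b, hb⟩ := exists_hasExp hΨ
  have h0 : ∀ᶠ x in 𝓝 0, conj (Ψ (p + x, star p + star x)) = Ψ (p + x, star p + star x) := by
    filter_upwards [eventually_nhds_iff_add.1 hΦ] with x hx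
    rw [← star_add, hx, Complex.conj_ofReal]
  filter_upwards [Metric.ball_mem_nhds _ hr] with x hx
  have := hb.conj_apply hr h0 (mem_ball_zero_iff.1 hx).le (y := 0) (by simpa using hr.le)
  simpa using this

lemma polarDiastasis_real (hΨ : AnalyticAt ℂ Ψ (p, star p))
    (hΦ : ∀ᶠ z in 𝓝 p, Ψ (z, star z) = Φ z) :
    ∀ᶠ x in 𝓝 0, polarDiastasis Ψ p (p + x, star (p + x)) =
      ((Φ (p + x) + Φ p - 2 * (Ψ (p + x, star p)).re : ℝ) : ℂ) := by
  filter_upwards [conj_polarization hΨ hΦ, eventually_nhds_iff_add.1 hΦ] with x hx hx'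
  rw [polarDiastasis, hx', hΦ.self_of_nhds, ← hx]
  push_cast
  have := Complex.add_conj (Ψ (p + x, star p))
  push_cast at this
  linear_combination -this

/-- With `h = Ψ(·, p̄) - Φ(p)/2` the diastasis is `Ψ - h - h̄` on the antidiagonal, so `e^Ψ = |e^h|²
e^D`. Multiplying by `|e^h|²` or by `|e^{-h}|²` preserves semidefiniteness, hence the two
exponentials have it together. -/
theorem isOneResolvableAt_iff {g : (Fin n → ℂ) → Matrix (Fin n) (Fin n) ℂ}
    {c : Matrix (Fin n → ℕ) (Fin n → ℕ) ℂ} {r : ℝ} (hr : 0 < r)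
    (hΨ : AnalyticAt ℂ Ψ (p, star p))
    (hΦ : ∀ᶠ z in 𝓝 p, Ψ (z, star z) = Φ z) (hg : ∀ᶠ z in 𝓝 p, metricOfPotential Φ z = g z)
    (hc : HasExp c r fun x y => Complex.exp (Ψ (p + x, star p + y))) :
    IsOneResolvableAt g p ↔ c.PosSemidef := by
  obtain ⟨ρ, hρ, b, hb⟩ := exists_hasExp (analyticAt_polarDiastasis hΨ).cexp
  replace hb : HasExp b ρ fun x y => Complex.exp (polarDiastasis Ψ p (p + x, star p + y)) := hb
  have hreal := polarDiastasis_real hΨ hΦ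
  have hherm : b.IsHermitian := hb.isHermitian hρ (by
    filter_upwards [hreal] with x hx
    rw [← star_add, hx, ← Complex.exp_conj, Complex.conj_ofReal])
  -- The polarized diastasis vanishes when one argument is the centre, so row `0` of its exponential
  -- is that of the constant `1`. This decouples the index `0` and makes the `-1` harmless.
  have hrow : ∀ β, b 0 β = if β = 0 then 1 else 0 := fun β => by
    have h1 := (hb.restrict hρ.le).unique (hasExp_one ρ) hρ hρ (by
      refine Filter.Eventually.of_forall fun x => ?_
      simp [polarDiastasis])
    have h2 := congrFun (congrFun h1 0) β
    simpa [Matrix.single_apply, eq_comm] using h2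
  have hcol : ∀ β, b β 0 = if β = 0 then 1 else 0 := fun β => by
    rw [← hherm.apply, hrow]; split_ifs <;> simp
  have hanal : AnalyticAt ℂ (fun x => Ψ (p + x, star p)) 0 :=
    AnalyticAt.fun_comp (g := Ψ) (f := fun x : Fin n → ℂ => (p + x, star p)) (by simpa using hΨ)
      ((analyticAt_const.add analyticAt_id).prod analyticAt_const)
  have hu : AnalyticAt ℂ (fun x => Ψ (p + x, star p) - (Φ p : ℂ) / 2) 0 :=
    hanal.sub analyticAt_const
  have hbc : b.PosSemidef ↔ c.PosSemidef := by
    have key : ∀ᶠ x in 𝓝 (0 : Fin n → ℂ), Complex.exp (Ψ (p + x, star p + star x)) =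
        Complex.exp (Ψ (p + x, star p) - Φ p / 2) *
          conj (Complex.exp (Ψ (p + x, star p) - Φ p / 2)) *
          Complex.exp (polarDiastasis Ψ p (p + x, star p + star x)) := by
      filter_upwards [conj_polarization hΨ hΦ] with x hx
      rw [← Complex.exp_conj, ← Complex.exp_add, ← Complex.exp_add, polarDiastasis,
        hΦ.self_of_nhds, map_sub, hx, map_div₀, Complex.conj_ofReal, star_add,
        Complex.conj_ofNat]
      congr 1
      ring
    constructor
    · exact posSemidef_of_mul_conj hρ hr hb hc hu.cexp key
    · refine posSemidef_of_mul_conj (f := fun x => Complex.exp (-(Ψ (p + x, star p) - (Φ p : ℂ) / 2)))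
        hr hρ hc hb hu.neg.cexp ?_
      filter_upwards [key] with x hx
      rw [hx, ← Complex.exp_conj, ← Complex.exp_conj, map_neg]
      simp only [← Complex.exp_add]
      congr 1
      ring
  rw [← hbc, ← posSemidef_sub_single_iff hrow hcol]
  have hexp : ∀ᶠ x in 𝓝 0, HasSum (fun m : (Fin n → ℕ) × (Fin n → ℕ) =>
      (b - Matrix.single 0 0 1 : Matrix (Fin n → ℕ) (Fin n → ℕ) ℂ) m.1 m.2 * monomial m.1 x * conj (monomial m.2 x))
      (Complex.exp (polarDiastasis Ψ p (p + x, star (p + x))) - 1) := by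
    filter_upwards [hb.eventually_hasSum hρ, (hasExp_one ρ).eventually_hasSum hρ] with x h1 h2
    rw [star_add]
    refine (h1.sub h2).congr_fun fun m => ?_
    rw [Matrix.sub_apply]; ring
  constructor
  · rintro ⟨D, b', hD, hsum, hpos⟩
    -- Whatever potential defines `D`, it is the same diastasis near `p`, so its coefficient matrix
    -- is forced.
    have hDW := eventually_nhds_iff_add.1 (hD.eventually_eq hΨ hΦ hg)
    have : b - Matrix.single 0 0 1 = b' := by
      refine eq_of_hasSum_star hexp ?_
      filter_upwards [eventually_nhds_iff_add.1 hsum, hDW] with x h1 h2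
      rw [add_sub_cancel_left] at h1
      push_cast at h1
      rwa [h2] at h1
    rwa [this]
  · intro hpos
    have hDre : ∀ᶠ z in 𝓝 p, (((polarDiastasis Ψ p (z, star z)).re : ℝ) : ℂ) =
        polarDiastasis Ψ p (z, star z) := by
      rw [eventually_nhds_iff_add]
      filter_upwards [hreal] with x hx
      rw [hx, Complex.ofReal_re]
    refine ⟨fun z => (polarDiastasis Ψ p (z, star z)).re, b - Matrix.single 0 0 1,
      isDiastasisAt_of_polarization hΨ hΦ hg hDre, ?_, hpos⟩
    rw [eventually_nhds_iff_add] at hDre ⊢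
    filter_upwards [hexp, hDre] with x h1 h2
    rw [add_sub_cancel_left]
    push_cast
    rwa [h2]

end resolvability

/-! ### Expansions on Cartan–Hartogs domains -/

lemma norm_apply_le_expNorm {n : ℕ} {b : Matrix (Fin n → ℕ) (Fin n → ℕ) ℂ} {r : ℝ}
    {F : (Fin n → ℂ) → (Fin n → ℂ) → ℂ} (h : HasExp b r F) {x y : Fin n → ℂ}
    (hx : ‖x‖ ≤ r) (hy : ‖y‖ ≤ r) : ‖F x y‖ ≤ expNorm b r := by
  rw [← (h.hasSum x y hx hy).tsum_eq]
  exact tsum_of_norm_bounded h.summable.hasSum (norm_term_le b hx hy)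

/-- Summable majorants make the family absolutely summable jointly in `m` and the multi-indices, so
the two summations may be exchanged. -/
theorem HasExp.tsum {n : ℕ} {b : ℕ → Matrix (Fin n → ℕ) (Fin n → ℕ) ℂ} {r : ℝ}
    {F : ℕ → (Fin n → ℂ) → (Fin n → ℂ) → ℂ} (hr : 0 < r) (h : ∀ m, HasExp (b m) r (F m))
    (hs : Summable fun m => expNorm (b m) r) :
    (∀ α β, Summable fun m => b m α β) ∧
      HasExp (fun α β => ∑' m, b m α β) r (fun x y => ∑' m, F m x y) := by
  have h1 : Summable fun s : ℕ × ((Fin n → ℕ) × (Fin n → ℕ)) =>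
      ‖b s.1 s.2.1 s.2.2‖ * r ^ (mdeg s.2.1 + mdeg s.2.2) := by
    refine (summable_prod_of_nonneg fun s => by positivity).2 ⟨fun m => (h m).summable, hs⟩
  have h2 : Summable fun s : ((Fin n → ℕ) × (Fin n → ℕ)) × ℕ =>
      ‖b s.2 s.1.1 s.1.2‖ * r ^ (mdeg s.1.1 + mdeg s.1.2) := h1.prod_symm
  have h3 : ∀ α β, Summable fun m => ‖b m α β‖ := fun α β => by
    have h4 : Summable fun m => ‖b m α β‖ * r ^ (mdeg α + mdeg β) :=
      Summable.prod_factor (f := fun s : ((Fin n → ℕ) × (Fin n → ℕ)) × ℕ =>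
        ‖b s.2 s.1.1 s.1.2‖ * r ^ (mdeg s.1.1 + mdeg s.1.2)) h2 (α, β)
    exact (summable_mul_right_iff (pow_pos hr (mdeg α + mdeg β)).ne').1 h4
  refine ⟨fun α β => (h3 α β).of_norm, ?_, fun x y hx hy => ?_⟩
  · have h4 : Summable fun s : (Fin n → ℕ) × (Fin n → ℕ) =>
        ∑' m, ‖b m s.1 s.2‖ * r ^ (mdeg s.1 + mdeg s.2) :=
      Summable.prod (f := fun s : ((Fin n → ℕ) × (Fin n → ℕ)) × ℕ =>
        ‖b s.2 s.1.1 s.1.2‖ * r ^ (mdeg s.1.1 + mdeg s.1.2)) h2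
    refine h4.of_nonneg_of_le (fun _ => by positivity) fun s => ?_
    rw [tsum_mul_right]
    gcongr
    exact norm_tsum_le_tsum_norm (h3 s.1 s.2)
  · have h4 : Summable fun s : ℕ × ((Fin n → ℕ) × (Fin n → ℕ)) =>
        b s.1 s.2.1 s.2.2 * monomial s.2.1 x * monomial s.2.2 y :=
      Summable.of_norm_bounded h1 fun s => norm_term_le (b s.1) hx hy s.2
    have h5 : HasSum (fun m => F m x y)
        (∑' s : ℕ × ((Fin n → ℕ) × (Fin n → ℕ)),
          b s.1 s.2.1 s.2.2 * monomial s.2.1 x * monomial s.2.2 y) :=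
      HasSum.prod_fiberwise (f := fun s : ℕ × ((Fin n → ℕ) × (Fin n → ℕ)) =>
        b s.1 s.2.1 s.2.2 * monomial s.2.1 x * monomial s.2.2 y) h4.hasSum
        fun m => (h m).hasSum x y hx hy
    have h6 : HasSum (fun s : ((Fin n → ℕ) × (Fin n → ℕ)) × ℕ =>
        b s.2 s.1.1 s.1.2 * monomial s.1.1 x * monomial s.1.2 y)
        (∑' s : ℕ × ((Fin n → ℕ) × (Fin n → ℕ)),
          b s.1 s.2.1 s.2.2 * monomial s.2.1 x * monomial s.2.2 y) :=
      ((Equiv.prodComm ((Fin n → ℕ) × (Fin n → ℕ)) ℕ).hasSum_iff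
        (f := fun s : ℕ × ((Fin n → ℕ) × (Fin n → ℕ)) =>
          b s.1 s.2.1 s.2.2 * monomial s.2.1 x * monomial s.2.2 y)).2 h4.hasSum
    rw [h5.tsum_eq]
    refine HasSum.prod_fiberwise (f := fun s : ((Fin n → ℕ) × (Fin n → ℕ)) × ℕ =>
        b s.2 s.1.1 s.1.2 * monomial s.1.1 x * monomial s.1.2 y) h6 fun s => ?_
    simp only [mul_assoc]
    exact ((h3 s.1 s.2).of_norm.hasSum).mul_right _

/-- The coefficients of `(w + x) ^ m`. -/
def binomCoeff (w : ℂ) (m i : ℕ) : ℂ := m.choose i * w ^ (m - i)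

lemma hasSum_binomCoeff (w x : ℂ) (m : ℕ) :
    HasSum (fun i => binomCoeff w m i * x ^ i) ((w + x) ^ m) := by
  rw [add_comm w x, add_pow]
  have : ∀ i, x ^ i * w ^ (m - i) * (m.choose i : ℂ) = binomCoeff w m i * x ^ i := fun i => by
    rw [binomCoeff]; ring
  simp only [this]
  refine hasSum_sum_of_ne_finset_zero fun i hi => ?_
  rw [binomCoeff, Nat.choose_eq_zero_of_lt (by simpa using hi)]
  simp

lemma hasSum_norm_binomCoeff (w : ℂ) (r : ℝ) (m : ℕ) :
    HasSum (fun i => ‖binomCoeff w m i‖ * r ^ i) ((‖w‖ + r) ^ m) := by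
  rw [add_comm ‖w‖ r, add_pow]
  have : ∀ i, r ^ i * ‖w‖ ^ (m - i) * (m.choose i : ℝ) = ‖binomCoeff w m i‖ * r ^ i :=
    fun i => by rw [binomCoeff, norm_mul, norm_pow, Complex.norm_natCast]; ring
  simp only [this]
  refine hasSum_sum_of_ne_finset_zero fun i hi => ?_
  rw [binomCoeff, Nat.choose_eq_zero_of_lt (by simpa using hi)]
  simp

/-- Splitting off the last entry of a pair of multi-indices. -/
def splitLast (d : ℕ) : (Fin (d + 1) → ℕ) × (Fin (d + 1) → ℕ) ≃
    ((Fin d → ℕ) × (Fin d → ℕ)) × (ℕ × ℕ) where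
  toFun m := ((Fin.init m.1, Fin.init m.2), (m.1 (Fin.last d), m.2 (Fin.last d)))
  invFun p := (Fin.snoc p.1.1 p.2.1, Fin.snoc p.1.2 p.2.2)
  left_inv m := by simp
  right_inv p := by simp

lemma monomial_succ {d : ℕ} (α : Fin (d + 1) → ℕ) (X : Fin (d + 1) → ℂ) :
    monomial α X = monomial (Fin.init α) (base X) * X (Fin.last d) ^ α (Fin.last d) := by
  rw [monomial, Fin.prod_univ_castSucc]; rfl

lemma mdeg_succ {d : ℕ} (α : Fin (d + 1) → ℕ) :
    mdeg α = mdeg (Fin.init α : Fin d → ℕ) + α (Fin.last d) := by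
  rw [mdeg, mdeg, Fin.sum_univ_castSucc]; rfl

lemma norm_base_le {d : ℕ} (X : Fin (d + 1) → ℂ) : ‖base X‖ ≤ ‖X‖ :=
  (pi_norm_le_iff_of_nonneg (norm_nonneg _)).2 fun i => norm_le_pi_norm X i.castSucc

/-- The coefficients of `((w + x) (w̄ + y)) ^ m F` around a point. -/
def fiberCoeff {d : ℕ} (b : Matrix (Fin d → ℕ) (Fin d → ℕ) ℂ) (w : ℂ) (m : ℕ) :
    Matrix (Fin (d + 1) → ℕ) (Fin (d + 1) → ℕ) ℂ :=
  fun α β => b (Fin.init α) (Fin.init β) *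
    (binomCoeff w m (α (Fin.last d)) * conj (binomCoeff w m (β (Fin.last d))))

lemma conj_binomCoeff (w : ℂ) (m i : ℕ) : conj (binomCoeff w m i) = binomCoeff (conj w) m i := by
  simp [binomCoeff]

/-- Splitting off the last exponents makes the coefficients a tensor product. The majorant then
factors, and the binomial theorem evaluates its fibre part exactly. -/
theorem HasExp.fiber {d : ℕ} {b : Matrix (Fin d → ℕ) (Fin d → ℕ) ℂ} {r : ℝ}
    {F : (Fin d → ℂ) → (Fin d → ℂ) → ℂ} (hr : 0 ≤ r) (h : HasExp b r F) (w : ℂ) (m : ℕ) :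
    HasExp (fiberCoeff b w m) r (fun X Y => F (base X) (base Y) *
      ((w + X (Fin.last d)) ^ m * (conj w + Y (Fin.last d)) ^ m)) ∧
    expNorm (fiberCoeff b w m) r = expNorm b r * ((‖w‖ + r) ^ m * (‖w‖ + r) ^ m) := by
  have hv := hasSum_norm_binomCoeff w r m
  have hv0 : ∀ i, 0 ≤ ‖binomCoeff w m i‖ * r ^ i := fun i => by positivity
  have hvv : Summable fun p : ℕ × ℕ =>
      ‖binomCoeff w m p.1‖ * r ^ p.1 * (‖binomCoeff w m p.2‖ * r ^ p.2) :=
    Summable.mul_of_nonneg (f := fun i => ‖binomCoeff w m i‖ * r ^ i)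
      (g := fun i => ‖binomCoeff w m i‖ * r ^ i) hv.summable hv.summable hv0 hv0
  have hvv' := HasSum.mul (f := fun i => ‖binomCoeff w m i‖ * r ^ i)
    (g := fun i => ‖binomCoeff w m i‖ * r ^ i) hv hv hvv
  have hb0 : ∀ s : (Fin d → ℕ) × (Fin d → ℕ), 0 ≤ ‖b s.1 s.2‖ * r ^ (mdeg s.1 + mdeg s.2) :=
    fun s => by positivity
  have hvv0 : ∀ p : ℕ × ℕ,
      0 ≤ ‖binomCoeff w m p.1‖ * r ^ p.1 * (‖binomCoeff w m p.2‖ * r ^ p.2) :=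
    fun p => by positivity
  have hall := HasSum.mul
    (f := fun s : (Fin d → ℕ) × (Fin d → ℕ) => ‖b s.1 s.2‖ * r ^ (mdeg s.1 + mdeg s.2))
    (g := fun p : ℕ × ℕ => ‖binomCoeff w m p.1‖ * r ^ p.1 * (‖binomCoeff w m p.2‖ * r ^ p.2))
    h.summable.hasSum hvv' (Summable.mul_of_nonneg
      (f := fun s : (Fin d → ℕ) × (Fin d → ℕ) => ‖b s.1 s.2‖ * r ^ (mdeg s.1 + mdeg s.2))
      (g := fun p : ℕ × ℕ => ‖binomCoeff w m p.1‖ * r ^ p.1 * (‖binomCoeff w m p.2‖ * r ^ p.2))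
      h.summable hvv hb0 hvv0)
  have hterm : ∀ s : (Fin (d + 1) → ℕ) × (Fin (d + 1) → ℕ),
      ‖fiberCoeff b w m s.1 s.2‖ * r ^ (mdeg s.1 + mdeg s.2) =
        ‖b (Fin.init s.1) (Fin.init s.2)‖ *
            r ^ (mdeg (Fin.init s.1 : Fin d → ℕ) + mdeg (Fin.init s.2 : Fin d → ℕ)) *
          (‖binomCoeff w m (s.1 (Fin.last d))‖ * r ^ s.1 (Fin.last d) *
            (‖binomCoeff w m (s.2 (Fin.last d))‖ * r ^ s.2 (Fin.last d))) := fun s => by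
    rw [fiberCoeff, norm_mul, norm_mul, RCLike.norm_conj, mdeg_succ, mdeg_succ]
    ring
  have hmain : HasSum (fun s : (Fin (d + 1) → ℕ) × (Fin (d + 1) → ℕ) =>
      ‖fiberCoeff b w m s.1 s.2‖ * r ^ (mdeg s.1 + mdeg s.2))
      (expNorm b r * ((‖w‖ + r) ^ m * (‖w‖ + r) ^ m)) := by
    rw [← (splitLast d).hasSum_iff] at hall
    exact hall.congr_fun hterm
  refine ⟨⟨hmain.summable, fun X Y hX hY => ?_⟩, hmain.tsum_eq⟩
  have hx := hasSum_binomCoeff w (X (Fin.last d)) m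
  have hy := hasSum_binomCoeff (conj w) (Y (Fin.last d)) m
  have hxn : ∀ (u x : ℂ), ‖u‖ = ‖w‖ → ‖x‖ ≤ r →
      Summable fun i => ‖binomCoeff u m i * x ^ i‖ := fun u x hu hx => by
    refine (hasSum_norm_binomCoeff u r m).summable.of_nonneg_of_le (fun _ => norm_nonneg _)
      fun i => ?_
    rw [norm_mul, norm_pow]; gcongr
  have hxs := hxn w _ rfl ((norm_le_pi_norm X (Fin.last d)).trans hX)
  have hys := hxn (conj w) _ (RCLike.norm_conj w) ((norm_le_pi_norm Y (Fin.last d)).trans hY)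
  have hxys : Summable fun p : ℕ × ℕ => ‖binomCoeff w m p.1 * X (Fin.last d) ^ p.1 *
      (binomCoeff (conj w) m p.2 * Y (Fin.last d) ^ p.2)‖ :=
    Summable.mul_norm (f := fun i => binomCoeff w m i * X (Fin.last d) ^ i)
      (g := fun i => binomCoeff (conj w) m i * Y (Fin.last d) ^ i) hxs hys
  have hxy := HasSum.mul (f := fun i => binomCoeff w m i * X (Fin.last d) ^ i)
    (g := fun i => binomCoeff (conj w) m i * Y (Fin.last d) ^ i) hx hy hxys.of_norm
  have hbX := (norm_base_le X).trans hX
  have hbY := (norm_base_le Y).trans hY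
  have hbs : Summable fun s : (Fin d → ℕ) × (Fin d → ℕ) =>
      ‖b s.1 s.2 * monomial s.1 (base X) * monomial s.2 (base Y)‖ :=
    h.summable.of_nonneg_of_le (fun _ => norm_nonneg _) (norm_term_le b hbX hbY)
  have hs := HasSum.mul (f := fun s : (Fin d → ℕ) × (Fin d → ℕ) =>
      b s.1 s.2 * monomial s.1 (base X) * monomial s.2 (base Y))
    (g := fun p : ℕ × ℕ => binomCoeff w m p.1 * X (Fin.last d) ^ p.1 *
      (binomCoeff (conj w) m p.2 * Y (Fin.last d) ^ p.2))
    (h.hasSum (base X) (base Y) hbX hbY) hxy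
    (summable_mul_of_summable_norm (f := fun s : (Fin d → ℕ) × (Fin d → ℕ) =>
      b s.1 s.2 * monomial s.1 (base X) * monomial s.2 (base Y))
    (g := fun p : ℕ × ℕ => binomCoeff w m p.1 * X (Fin.last d) ^ p.1 *
      (binomCoeff (conj w) m p.2 * Y (Fin.last d) ^ p.2)) hbs hxys)
  rw [← (splitLast d).hasSum_iff] at hs
  refine hs.congr_fun fun s => ?_
  rw [fiberCoeff, monomial_succ, monomial_succ, conj_binomCoeff]
  simp only [splitLast, Equiv.coe_fn_mk, Function.comp_apply]
  ring

/-- The coefficients of `∑ a_m ((w + x) (w̄ + y)) ^ m F_m`. -/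
def totalCoeff {d : ℕ} (a : ℕ → ℝ) (k : ℕ → Matrix (Fin d → ℕ) (Fin d → ℕ) ℂ) (w : ℂ) :
    Matrix (Fin (d + 1) → ℕ) (Fin (d + 1) → ℕ) ℂ :=
  fun α β => ∑' m, (a m : ℂ) * fiberCoeff (k m) w m α β

/-- The fibre factor has rank one, so it can be absorbed into the test vector. -/
lemma posSemidef_fiberCoeff {d : ℕ} {b : Matrix (Fin d → ℕ) (Fin d → ℕ) ℂ} (hb : b.PosSemidef)
    (w : ℂ) (m : ℕ) : (fiberCoeff b w m).PosSemidef := by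
  refine posSemidef_of_sum_nonneg ?_ fun s x => ?_
  · ext α β
    have := hb.1.apply (Fin.init α) (Fin.init β)
    simp only [Matrix.conjTranspose_apply, fiberCoeff, star_mul', RCLike.star_def,
      Complex.conj_conj] at this ⊢
    rw [this]
    ring
  · refine (posSemidef_sum_nonneg hb s (fun α => Fin.init α)
      (fun α => conj (binomCoeff w m (α (Fin.last d))) * x α)).trans_eq
      (Finset.sum_congr rfl fun α _ => Finset.sum_congr rfl fun β _ => ?_)
    simp only [fiberCoeff, map_mul, Complex.conj_conj]
    ring

/-- Each value of the quadratic form involves finitely many entries, so it is a convergent sum of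
nonnegative terms. -/
lemma posSemidef_tsum {ι : Type*} {b : ℕ → Matrix ι ι ℂ} (hb : ∀ m, (b m).PosSemidef)
    (hs : ∀ i j, Summable fun m => b m i j) :
    Matrix.PosSemidef (fun i j => ∑' m, b m i j : Matrix ι ι ℂ) := by
  refine posSemidef_of_sum_nonneg ?_ fun s x => ?_
  · ext i j
    change star (∑' m, b m j i) = ∑' m, b m i j
    rw [tsum_star]
    exact tsum_congr fun m => (hb m).1.apply i j
  · have h1 : HasSum (fun m => ∑ k ∈ s, ∑ l ∈ s, conj (x k) * b m k l * x l)
        (∑ k ∈ s, ∑ l ∈ s, conj (x k) * (∑' m, b m k l) * x l) :=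
      hasSum_sum fun k _ => hasSum_sum fun l _ => ((hs k l).hasSum.mul_left _).mul_right _
    exact h1.nonneg fun m => posSemidef_sum_nonneg (hb m) s id x

/-- At `w = 0` the `j`-th summand involves only the last exponent `j`, so a single term survives.
This is why the converse needs only points with `w = 0`. -/
lemma totalCoeff_zero {d : ℕ} (a : ℕ → ℝ) (k : ℕ → Matrix (Fin d → ℕ) (Fin d → ℕ) ℂ) (m : ℕ)
    (α β : Fin d → ℕ) :
    totalCoeff a k 0 (Fin.snoc α m) (Fin.snoc β m) = a m * k m α β := by
  rw [totalCoeff, tsum_eq_single m]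
  · simp [fiberCoeff, binomCoeff]
  · intro j hj
    rcases lt_or_gt_of_ne hj with h | h
    · simp [fiberCoeff, binomCoeff, Nat.choose_eq_zero_of_lt h]
    · simp [fiberCoeff, binomCoeff, Nat.sub_ne_zero_of_lt h]

lemma posSemidef_of_totalCoeff {d : ℕ} {a : ℕ → ℝ}
    {k : ℕ → Matrix (Fin d → ℕ) (Fin d → ℕ) ℂ} (ha : ∀ m, 0 < a m)
    (h : (totalCoeff a k 0).PosSemidef) (m : ℕ) : (k m).PosSemidef := by
  have h1 := (h.submatrix fun α : Fin d → ℕ => (Fin.snoc α m : Fin (d + 1) → ℕ)).smul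
    (a := (a m)⁻¹) (inv_nonneg.2 (ha m).le)
  convert h1 using 1
  ext α β
  rw [Matrix.smul_apply, Matrix.submatrix_apply, totalCoeff_zero, Complex.real_smul, ← mul_assoc]
  have : (a m : ℂ) ≠ 0 := by exact_mod_cast (ha m).ne'
  push_cast
  rw [inv_mul_cancel₀ this, one_mul]

/-! ### The binomial series and the fibred expansion. -/

/-- The coefficients of `(1 - s) ^ (-c)`. -/
def negBinom (c : ℝ) (m : ℕ) : ℝ := Ring.choose (c + m - 1) m

/-- Up to the factor `m!` this is the rising factorial `c(c+1)⋯(c+m-1)`. -/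
lemma negBinom_pos {c : ℝ} (hc : 0 < c) (m : ℕ) : 0 < negBinom c m := by
  rw [negBinom, ← Ring.multichoose_eq]
  have h := Ring.factorial_nsmul_multichoose_eq_ascPochhammer c m
  rw [Polynomial.ascPochhammer_smeval_eq_eval] at h
  have h1 := ascPochhammer_pos m c hc
  rw [← h, nsmul_eq_mul] at h1
  exact pos_of_mul_pos_right h1 (by positivity)

lemma hasSum_negBinom (c : ℝ) {s : ℂ} (hs : ‖s‖ < 1) :
    HasSum (fun m => (negBinom c m : ℂ) * s ^ m) (Complex.exp (-(c * Complex.log (1 - s)))) := by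
  have h := (Complex.one_div_one_sub_cpow_hasFPowerSeriesOnBall_zero c).hasSum (y := s)
    (by rw [Metric.mem_eball, edist_zero_right, enorm_eq_nnnorm]; exact_mod_cast hs)
  have h1 : (1 : ℂ) - s ≠ 0 := fun h => by
    rw [← sub_eq_zero.1 h, norm_one] at hs; exact lt_irrefl _ hs
  rw [zero_add, Complex.cpow_def_of_ne_zero h1, one_div, ← Complex.exp_neg,
    mul_comm (Complex.log _)] at h
  refine h.congr_fun fun m => ?_
  rw [FormalMultilinearSeries.ofScalars_apply_eq, smul_eq_mul, negBinom]
  congr 1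
  rw [Complex.ofReal_choose]
  push_cast
  rfl

lemma summable_negBinom {c : ℝ} (hc : 0 < c) {t : ℝ} (h0 : 0 ≤ t) (ht : t < 1) :
    Summable fun m => negBinom c m * t ^ m := by
  have h := (hasSum_negBinom c (s := t) (by rwa [Complex.norm_real, Real.norm_of_nonneg h0])).summable
  refine h.norm.congr fun m => ?_
  rw [norm_mul, norm_pow, Complex.norm_real, Complex.norm_real, Real.norm_of_nonneg h0,
    Real.norm_of_nonneg (negBinom_pos hc m).le]

/-- Every nonconstant monomial gains at least one factor `r / r₀`. Hence the majorant is nearly `‖F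
0 0‖` on small polydiscs. -/
lemma expNorm_le {n : ℕ} {b : Matrix (Fin n → ℕ) (Fin n → ℕ) ℂ} {r₀ r : ℝ}
    {F : (Fin n → ℂ) → (Fin n → ℂ) → ℂ} (h : HasExp b r₀ F) (hr : 0 ≤ r) (hr₀ : 0 < r₀)
    (hle : r ≤ r₀) : expNorm b r ≤ ‖F 0 0‖ + r / r₀ * expNorm b r₀ := by
  have h00 : F 0 0 = b 0 0 := by
    have h1 := h.hasSum 0 0 (by simpa using hr₀.le) (by simpa using hr₀.le)
    refine h1.unique ?_
    convert hasSum_single ((0 : Fin n → ℕ), (0 : Fin n → ℕ)) ?_ using 1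
    · simp [monomial_zero]
    · rintro ⟨α, β⟩ hm
      by_cases hα : α = 0
      · have hβ : β ≠ 0 := fun hβ => hm (by rw [hα, hβ])
        simp [monomial_apply_zero, hβ]
      · simp [monomial_apply_zero, hα]
  rw [h00]
  have h2 : HasSum (fun m : (Fin n → ℕ) × (Fin n → ℕ) =>
      (if m = (0, 0) then ‖b 0 0‖ else 0) +
        r / r₀ * (‖b m.1 m.2‖ * r₀ ^ (mdeg m.1 + mdeg m.2)))
      (‖b 0 0‖ + r / r₀ * expNorm b r₀) :=
    (hasSum_ite_eq _ _).add (h.summable.hasSum.mul_left _)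
  refine hasSum_le (fun m => ?_) (h.mono hr hle).summable.hasSum h2
  by_cases hm : m = (0, 0)
  · subst hm
    simp only [mdeg_zero, if_true, pow_zero, mul_one, add_zero]
    have : 0 ≤ r / r₀ * ‖b 0 0‖ := by positivity
    linarith
  · rw [if_neg hm, zero_add]
    have hk : mdeg m.1 + mdeg m.2 ≠ 0 := fun h => hm (by
      rw [Nat.add_eq_zero_iff, mdeg_eq_zero, mdeg_eq_zero] at h
      exact Prod.ext h.1 h.2)
    have h3 : r ^ (mdeg m.1 + mdeg m.2) ≤ r / r₀ * r₀ ^ (mdeg m.1 + mdeg m.2) := by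
      obtain ⟨k, hk⟩ := Nat.exists_eq_succ_of_ne_zero hk
      rw [hk, pow_succ, pow_succ]
      calc r ^ k * r ≤ r₀ ^ k * r := by gcongr
        _ = r / r₀ * (r₀ ^ k * r₀) := by field_simp
    calc _ ≤ ‖b m.1 m.2‖ * (r / r₀ * r₀ ^ (mdeg m.1 + mdeg m.2)) := by gcongr
      _ = _ := by ring

/-- The coefficients of `F G ^ m`. -/
def powCoeff {n : ℕ} (a e : Matrix (Fin n → ℕ) (Fin n → ℕ) ℂ) :
    ℕ → Matrix (Fin n → ℕ) (Fin n → ℕ) ℂ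
  | 0 => a
  | m + 1 => cauchyMul (powCoeff a e m) e

lemma HasExp.powCoeff {n : ℕ} {a e : Matrix (Fin n → ℕ) (Fin n → ℕ) ℂ} {r : ℝ}
    {F G : (Fin n → ℂ) → (Fin n → ℂ) → ℂ} (hF : HasExp a r F) (hG : HasExp e r G) (hr : 0 ≤ r)
    (m : ℕ) : HasExp (powCoeff a e m) r (fun x y => F x y * G x y ^ m) ∧
      expNorm (CartanHartogs.powCoeff a e m) r ≤ expNorm a r * expNorm e r ^ m := by
  induction m with
  | zero => simpa [CartanHartogs.powCoeff] using hF
  | succ m ih =>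
    obtain ⟨h1, h2⟩ := ih.1.mul hG hr
    refine ⟨h1.congr fun x y _ _ => by ring, h2.trans ?_⟩
    rw [pow_succ, ← mul_assoc]
    exact mul_le_mul_of_nonneg_right ih.2 (expNorm_nonneg e hr)

/-- The identity is `e^{cl} (1 - s)^{-c} = ∑ a_m (w w')^m e^{(c+m) l}` with `s = w w' e^l`. The
hypothesis `hP` says `|s| < 1` at the centre, and it has to survive for majorants on a small
polydisc. -/
theorem exists_hasExp_fibration {d : ℕ} {l : (Fin d → ℂ) × (Fin d → ℂ) → ℂ}
    {P : Fin (d + 1) → ℂ} (hl : AnalyticAt ℂ l (base P, star (base P))) {c : ℝ} (hc : 0 < c)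
    (hP : ‖P (Fin.last d)‖ ^ 2 * ‖Complex.exp (l (base P, star (base P)))‖ < 1) :
    ∃ r > 0, ∃ k : ℕ → Matrix (Fin d → ℕ) (Fin d → ℕ) ℂ,
      (∀ m, HasExp (k m) r fun x y =>
        Complex.exp ((c + m) * l (base P + x, star (base P) + y))) ∧
      (∀ α β, Summable fun m =>
        (negBinom c m : ℂ) * fiberCoeff (k m) (P (Fin.last d)) m α β) ∧
      HasExp (totalCoeff (negBinom c) k (P (Fin.last d))) r fun X Y =>
        Complex.exp (c * (l (base (P + X), base (star P + Y)) -
          Complex.log (1 - (P + X) (Fin.last d) * (star P + Y) (Fin.last d) *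
            Complex.exp (l (base (P + X), base (star P + Y)))))) := by
  set w := P (Fin.last d) with hw
  set p := base P with hp
  obtain ⟨r₁, hr₁, a, ha⟩ := exists_hasExp
    (F := fun q => Complex.exp (c * l q)) (analyticAt_const.mul hl).cexp
  obtain ⟨r₂, hr₂, e, he⟩ := exists_hasExp (F := fun q => Complex.exp (l q)) hl.cexp
  -- As `r → 0` the bound from `expNorm_le` tends to the left side of `hP`, so the strict inequality
  -- persists for small `r`.
  obtain ⟨r, hr0, hr1, hr2, hrQ⟩ : ∃ r > 0, r ≤ r₁ ∧ r ≤ r₂ ∧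
      (‖w‖ + r) ^ 2 * expNorm e r < 1 := by
    have hcont : ContinuousAt (fun r : ℝ => (‖w‖ + r) ^ 2 *
        (‖Complex.exp (l (p, star p))‖ + r / r₂ * expNorm e r₂)) 0 := by fun_prop
    have h1 := hcont.eventually_lt_const (u := 1) (by simpa using hP)
    have h2 : ∀ᶠ r in 𝓝[>] (0 : ℝ), r ≤ r₁ ∧ r ≤ r₂ ∧ 0 < r ∧ (‖w‖ + r) ^ 2 *
        (‖Complex.exp (l (p, star p))‖ + r / r₂ * expNorm e r₂) < 1 := by
      filter_upwards [nhdsWithin_le_nhds h1, nhdsWithin_le_nhds (eventually_le_nhds hr₁),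
        nhdsWithin_le_nhds (eventually_le_nhds hr₂), self_mem_nhdsWithin] with r h h' h'' h3
      exact ⟨h', h'', h3, h⟩
    obtain ⟨r, h3, h4, h5, h6⟩ := h2.exists
    refine ⟨r, h5, h3, h4, lt_of_le_of_lt ?_ h6⟩
    gcongr
    simpa using expNorm_le he h5.le hr₂ h4
  have haR := ha.mono hr0.le hr1
  have heR := he.mono hr0.le hr2
  set Q := expNorm e r with hQ
  have hQ0 : 0 ≤ Q := expNorm_nonneg e hr0.le
  -- Writing `e^{(c+m) l}` as `e^{cl} (e^l)^m` keeps one radius for all `m`; separate expansions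
  -- would not control it.
  have hk := fun m => haR.powCoeff heR hr0.le m
  have hf := fun m => (hk m).1.fiber hr0.le w m
  have hscale : ∀ m, HasExp (fun α β => (negBinom c m : ℂ) * fiberCoeff (powCoeff a e m) w m α β) r
      (fun X Y => (negBinom c m : ℂ) *
        (Complex.exp (c * l (p + base X, star p + base Y)) *
          Complex.exp (l (p + base X, star p + base Y)) ^ m *
        ((w + X (Fin.last d)) ^ m * (conj w + Y (Fin.last d)) ^ m))) := fun m => by
    refine ⟨?_, fun X Y hX hY => ?_⟩
    · refine ((hf m).1.summable.mul_left ‖(negBinom c m : ℂ)‖).congr fun s => ?_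
      rw [norm_mul, mul_assoc]
    · refine (((hf m).1.hasSum X Y hX hY).mul_left (negBinom c m : ℂ)).congr_fun fun s => ?_
      ring
  have hnorm : Summable fun m => expNorm (fun α β =>
      (negBinom c m : ℂ) * fiberCoeff (powCoeff a e m) w m α β) r := by
    -- The majorants are dominated by the binomial series at `(‖w‖ + r)² Q < 1`.
    refine ((summable_negBinom hc (t := (‖w‖ + r) ^ 2 * Q) (by positivity) hrQ).mul_left
      (expNorm a r)).of_nonneg_of_le (fun m => expNorm_nonneg _ hr0.le) fun m => ?_
    have h1 : expNorm (fun α β =>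
      (negBinom c m : ℂ) * fiberCoeff (powCoeff a e m) w m α β) r =
        negBinom c m * expNorm (fiberCoeff (powCoeff a e m) w m) r := by
      unfold expNorm
      rw [← tsum_mul_left]
      refine tsum_congr fun s => ?_
      rw [norm_mul, Complex.norm_real, Real.norm_of_nonneg (negBinom_pos hc m).le, mul_assoc]
    rw [h1, (hf m).2]
    calc _ ≤ negBinom c m * ((expNorm a r * Q ^ m) * ((‖w‖ + r) ^ m * (‖w‖ + r) ^ m)) := by
          have := (negBinom_pos hc m).le
          gcongr
          exact (hk m).2
      _ = _ := by rw [mul_pow, ← pow_mul, two_mul, pow_add]; ring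
  have htot := HasExp.tsum hr0 hscale hnorm
  refine ⟨r, hr0, powCoeff a e, fun m => (hk m).1.congr fun x y _ _ => ?_, htot.1,
    htot.2.congr fun X Y hX hY => ?_⟩
  · rw [← Complex.exp_nat_mul, ← Complex.exp_add]
    ring_nf
  · have hbX : base (P + X) = p + base X := rfl
    have hbY : base (star P + Y) = star p + base Y := rfl
    rw [hbX, hbY]
    have hE := norm_apply_le_expNorm heR ((norm_base_le X).trans hX) ((norm_base_le Y).trans hY)
    set E := l (p + base X, star p + base Y) with hEdef
    have hs : ‖(P + X) (Fin.last d) * (star P + Y) (Fin.last d) * Complex.exp E‖ < 1 := by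
      refine lt_of_le_of_lt ?_ hrQ
      rw [norm_mul, norm_mul, sq]
      have h1 : ‖(P + X) (Fin.last d)‖ ≤ ‖w‖ + r :=
        (norm_add_le _ _).trans (add_le_add_right ((norm_le_pi_norm X _).trans hX) _)
      have h2 : ‖(star P + Y) (Fin.last d)‖ ≤ ‖w‖ + r := by
        refine (norm_add_le _ _).trans (add_le_add ?_ ((norm_le_pi_norm Y _).trans hY))
        rw [Pi.star_apply, norm_star]
      gcongr
    have h1 := (hasSum_negBinom c hs).mul_left (Complex.exp (c * E))
    rw [← Complex.exp_add] at h1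
    rw [mul_sub, sub_eq_add_neg, ← h1.tsum_eq]
    refine tsum_congr fun m => ?_
    have h2 : (star P + Y) (Fin.last d) = conj w + Y (Fin.last d) := rfl
    have h3 : (P + X) (Fin.last d) = w + X (Fin.last d) := rfl
    rw [h2, h3, mul_pow, mul_pow]
    ring

/-! ### The Bergman kernel -/

lemma measurePreserving_rotate {d : ℕ} (θ : ℝ) :
    MeasurePreserving (fun v : Fin d → ℂ => Complex.exp (θ * Complex.I) • v) := by
  have h : MeasurePreserving (rotation (Circle.exp θ)) (volume : Measure ℂ) volume :=
    (rotation (Circle.exp θ)).measurePreserving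
  have h1 := volume_preserving_pi (fun _ : Fin d => h)
  convert h1 using 1
  funext v i
  simp [rotation_apply]

lemma measurableEmbedding_rotate {d : ℕ} (θ : ℝ) :
    MeasurableEmbedding (fun v : Fin d → ℂ => Complex.exp (θ * Complex.I) • v) :=
  (Homeomorph.smulOfNeZero (α := Fin d → ℂ) (Complex.exp (θ * Complex.I))
    (Complex.exp_ne_zero _)).measurableEmbedding

/-- The mean value property over a balanced set. -/
theorem setIntegral_eq_of_balanced {d : ℕ} {S Ω : Set (Fin d → ℂ)} {f : (Fin d → ℂ) → ℂ}
    {z : Fin d → ℂ} (hS : MeasurableSet S)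
    (hbal : ∀ v ∈ S, ∀ t : ℂ, ‖t‖ ≤ 1 → t • v ∈ S) (hΩ : IsOpen Ω)
    (hmap : ∀ v ∈ S, z + v ∈ Ω) (hf : DifferentiableOn ℂ f Ω)
    (hint : IntegrableOn (fun v => f (z + v)) S) :
    ∫ v in S, f (z + v) = volume.real S * f z := by
  have hnorm : ∀ θ : ℝ, ‖Complex.exp (θ * Complex.I)‖ = 1 := Complex.norm_exp_ofReal_mul_I
  have hpre : ∀ θ : ℝ, (fun v : Fin d → ℂ => Complex.exp (θ * Complex.I) • v) ⁻¹' S = S := by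
    intro θ
    ext v
    refine ⟨fun h => ?_, fun h => hbal v h _ (hnorm θ).le⟩
    have h1 := hbal _ h (Complex.exp (-θ * Complex.I))
      (by have := hnorm (-θ); push_cast at this; exact this.le)
    rwa [smul_smul, ← Complex.exp_add, neg_mul, neg_add_cancel, Complex.exp_zero, one_smul] at h1
  have h1 : ∀ θ : ℝ, ∫ v in S, f (z + Complex.exp (θ * Complex.I) • v) = ∫ v in S, f (z + v) := by
    intro θ
    have := (measurePreserving_rotate (d := d) θ).setIntegral_preimage_emb
      (measurableEmbedding_rotate θ) (fun v => f (z + v)) S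
    rwa [hpre] at this
  have h1n : ∀ θ : ℝ, ∫ v in S, ‖f (z + Complex.exp (θ * Complex.I) • v)‖ =
      ∫ v in S, ‖f (z + v)‖ := by
    intro θ
    have := (measurePreserving_rotate (d := d) θ).setIntegral_preimage_emb
      (measurableEmbedding_rotate θ) (fun v => ‖f (z + v)‖) S
    rwa [hpre] at this
  have h1i : ∀ θ : ℝ, IntegrableOn (fun v => f (z + Complex.exp (θ * Complex.I) • v)) S := by
    intro θ
    have := (measurePreserving_rotate (d := d) θ).integrableOn_comp_preimage
      (measurableEmbedding_rotate θ) (f := fun v => f (z + v)) (s := S)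
    rw [hpre] at this
    exact this.2 hint
  -- Balancedness keeps the disc `t ↦ z + t v` inside `Ω`, so the circle mean value property applies
  -- along it.
  have h2 : ∀ v ∈ S, ∫ θ in (0 : ℝ)..(2 * Real.pi), f (z + Complex.exp (θ * Complex.I) • v) =
      2 * Real.pi * f z := by
    intro v hv
    have hd : DiffContOnCl ℂ (fun t : ℂ => f (z + t • v)) (Metric.ball 0 |1|) := by
      refine DifferentiableOn.diffContOnCl fun t ht => ?_
      rw [abs_one, closure_ball (0 : ℂ) one_ne_zero, mem_closedBall_zero_iff] at ht
      have h3 : DifferentiableAt ℂ f (z + t • v) :=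
        hf.differentiableAt (hΩ.mem_nhds (hmap _ (hbal v hv t ht)))
      exact (h3.comp t (by fun_prop : DifferentiableAt ℂ (fun t : ℂ => z + t • v)
        t)).differentiableWithinAt
    have h3 := hd.circleAverage
    rw [Real.circleAverage_def] at h3
    simp only [circleMap_zero, Complex.ofReal_one, one_mul, zero_smul, add_zero] at h3
    rw [← h3, Complex.real_smul]
    push_cast
    rw [← mul_assoc, mul_inv_cancel₀, one_mul]
    exact mul_ne_zero two_ne_zero (by exact_mod_cast Real.pi_ne_zero)
  have hcont : ContinuousOn (fun p : ℝ × (Fin d → ℂ) =>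
      f (z + Complex.exp (p.1 * Complex.I) • p.2)) (Set.Ioc 0 (2 * Real.pi) ×ˢ S) := by
    refine hf.continuousOn.comp (by fun_prop) fun p hp => hmap _ (hbal _ hp.2 _ (hnorm _).le)
  have hprod : Integrable (fun p : ℝ × (Fin d → ℂ) =>
      f (z + Complex.exp (p.1 * Complex.I) • p.2))
      ((volume.restrict (Set.Ioc 0 (2 * Real.pi))).prod (volume.restrict S)) := by
    rw [integrable_prod_iff]
    · refine ⟨Filter.Eventually.of_forall fun θ => h1i θ, ?_⟩
      simp only [h1n]
      exact integrable_const _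
    · rw [Measure.prod_restrict]
      exact hcont.aestronglyMeasurable (measurableSet_Ioc.prod hS)
  -- The integral over `S` does not depend on `θ`, while the integral over `θ` is known for each
  -- `v`; Fubini compares the two.
  have h3 := integral_integral_swap (f := fun (θ : ℝ) (v : Fin d → ℂ) =>
    f (z + Complex.exp (θ * Complex.I) • v)) hprod
  have h4 : ∫ v in S, ∫ θ in Set.Ioc 0 (2 * Real.pi), f (z + Complex.exp (θ * Complex.I) • v) =
      ∫ v in S, 2 * Real.pi * f z := by
    refine setIntegral_congr_fun hS fun v hv => ?_
    have := h2 v hv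
    rwa [intervalIntegral.integral_of_le (by positivity)] at this
  rw [h4] at h3
  simp only [h1, setIntegral_const, measureReal_def, Real.volume_Ioc, sub_zero] at h3
  rw [ENNReal.toReal_ofReal (by positivity), Complex.real_smul, Complex.real_smul] at h3
  push_cast at h3
  have hpi : (2 * Real.pi : ℂ) ≠ 0 :=
    mul_ne_zero two_ne_zero (by exact_mod_cast Real.pi_ne_zero)
  refine mul_left_cancel₀ hpi (h3.trans ?_)
  rw [measureReal_def]
  ring

section kernel

variable {d : ℕ} {Ω : Set (Fin d → ℂ)}

/-- The average of a square integrable function over a ball. -/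
def ballAverage (Ω : Set (Fin d → ℂ)) (z : Fin d → ℂ) (r : ℝ)
    (g : Lp ℂ 2 (volume.restrict Ω)) : ℂ :=
  ((volume.real (Metric.ball (0 : Fin d → ℂ) r) : ℝ) : ℂ)⁻¹ *
    ∫ ζ in Metric.ball z r, g ζ ∂(volume.restrict Ω)

lemma restrict_ball_ne_top (z : Fin d → ℂ) (r : ℝ) :
    (volume.restrict Ω) (Metric.ball z r) ≠ ⊤ :=
  ((Measure.restrict_apply_le _ _).trans_lt measure_ball_lt_top).ne

/-- As an inner product the average is linear and bounded in `g`; for holomorphic functions it is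
point evaluation. -/
lemma ballAverage_eq (z : Fin d → ℂ) (r : ℝ) (g : Lp ℂ 2 (volume.restrict Ω)) :
    ballAverage Ω z r g = ((volume.real (Metric.ball (0 : Fin d → ℂ) r) : ℝ) : ℂ)⁻¹ *
      inner ℂ (indicatorConstLp 2 Metric.isOpen_ball.measurableSet
        (restrict_ball_ne_top z r) (1 : ℂ)) g := by
  rw [ballAverage, L2.inner_indicatorConstLp_one]

lemma ballAverage_sub (z : Fin d → ℂ) (r : ℝ) (g g' : Lp ℂ 2 (volume.restrict Ω)) :
    ballAverage Ω z r (g - g') = ballAverage Ω z r g - ballAverage Ω z r g' := by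
  rw [ballAverage_eq, ballAverage_eq, ballAverage_eq, inner_sub_right, mul_sub]

lemma norm_ballAverage_le (z : Fin d → ℂ) (r : ℝ) (g : Lp ℂ 2 (volume.restrict Ω)) :
    ‖ballAverage Ω z r g‖ ≤ (volume.real (Metric.ball (0 : Fin d → ℂ) r))⁻¹ *
      volume.real (Metric.ball (0 : Fin d → ℂ) r) ^ (1 / 2 : ℝ) * ‖g‖ := by
  rw [ballAverage_eq, norm_mul, norm_inv, Complex.norm_real, Real.norm_of_nonneg measureReal_nonneg,
    mul_assoc]
  gcongr
  refine (norm_inner_le_norm _ _).trans ?_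
  gcongr
  rw [norm_indicatorConstLp (by simp) (by simp)]
  simp only [norm_one, one_mul, ENNReal.toReal_ofNat]
  gcongr
  rw [measureReal_def, measureReal_def]
  refine ENNReal.toReal_mono measure_ball_lt_top.ne ((Measure.restrict_apply_le _ _).trans ?_)
  rw [Measure.addHaar_ball_center]

/-- Square integrable holomorphic functions are their averages. -/
lemma ballAverage_of_mem (hΩ : IsOpen Ω) {f : (Fin d → ℂ) → ℂ} (hf : f ∈ L2hol Ω)
    {g : Lp ℂ 2 (volume.restrict Ω)} (hg : g =ᵐ[volume.restrict Ω] f) {z : Fin d → ℂ} {r : ℝ}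
    (hr : 0 < r) (hz : Metric.closedBall z r ⊆ Ω) : ballAverage Ω z r g = f z := by
  have hzb := Metric.ball_subset_closedBall.trans hz
  have h1 : ∫ ζ in Metric.ball z r, g ζ ∂(volume.restrict Ω) = ∫ ζ in Metric.ball z r, f ζ := by
    rw [integral_congr_ae (ae_restrict_of_ae hg),
      Measure.restrict_restrict Metric.isOpen_ball.measurableSet, Set.inter_eq_left.2 hzb]
  have hmp : MeasurePreserving (fun v : Fin d → ℂ => z + v) := measurePreserving_add_left _ z
  have h2 := hmp.setIntegral_preimage_emb (measurableEmbedding_addLeft z) f (Metric.ball z r)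
  have hpre : (fun v : Fin d → ℂ => z + v) ⁻¹' Metric.ball z r = Metric.ball 0 r := by
    ext v; simp
  rw [hpre] at h2
  have hcl : ∀ v ∈ Metric.closedBall (0 : Fin d → ℂ) r, z + v ∈ Ω := fun v hv =>
    hz (by simpa [mem_closedBall_iff_norm] using hv)
  have h3 := setIntegral_eq_of_balanced (S := Metric.ball (0 : Fin d → ℂ) r) (z := z) (f := f)
    Metric.isOpen_ball.measurableSet (fun v hv t ht => by
      rw [mem_ball_zero_iff] at hv ⊢
      rw [norm_smul]
      exact (mul_le_of_le_one_left (norm_nonneg v) ht).trans_lt hv) hΩ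
    (fun v hv => hcl v (Metric.ball_subset_closedBall hv)) hf.1
    ((ContinuousOn.integrableOn_compact (isCompact_closedBall (0 : Fin d → ℂ) r)
      (hf.1.continuousOn.comp (by fun_prop) hcl)).mono_set Metric.ball_subset_closedBall)
  rw [ballAverage, h1, ← h2, h3, ← mul_assoc, inv_mul_cancel₀, one_mul]
  have : 0 < volume.real (Metric.ball (0 : Fin d → ℂ) r) :=
    ENNReal.toReal_pos (Metric.measure_ball_pos _ _ hr).ne' measure_ball_lt_top.ne
  exact_mod_cast this.ne'

/-- The Bergman space in `L²(Ω)`. -/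
def bergmanSpace (Ω : Set (Fin d → ℂ)) : Submodule ℂ (Lp ℂ 2 (volume.restrict Ω)) where
  carrier := {g | ∃ f ∈ L2hol Ω, g =ᵐ[volume.restrict Ω] f}
  add_mem' := by
    rintro g g' ⟨f, hf, hg⟩ ⟨f', hf', hg'⟩
    exact ⟨f + f', ⟨hf.1.add hf'.1, hf.2.add hf'.2⟩, (Lp.coeFn_add g g').trans (hg.add hg')⟩
  zero_mem' := ⟨0, ⟨differentiableOn_const 0, MemLp.zero⟩, Lp.coeFn_zero _ _ _⟩
  smul_mem' := by
    rintro c g ⟨f, hf, hg⟩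
    exact ⟨c • f, ⟨hf.1.const_smul c, hf.2.const_smul c⟩,
      (Lp.coeFn_smul c g).trans (hg.const_smul c)⟩

end kernel

section kernel

variable {d : ℕ} {Ω : Set (Fin d → ℂ)}

/-- Ball averages turn `L²` convergence into uniform bounds on small balls. Cauchy estimates do the
same for the derivatives, so the pointwise limit is holomorphic; it represents the `L²` limit. -/
theorem isClosed_bergmanSpace (hΩ : IsOpen Ω) :
    IsClosed (bergmanSpace Ω : Set (Lp ℂ 2 (volume.restrict Ω))) := by
  refine IsSeqClosed.isClosed fun g g₀ hg hlim => ?_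
  choose f hf hgf using hg
  have hR : ∀ z ∈ Ω, ∃ R > 0, Metric.closedBall z R ⊆ Ω := fun z hz =>
    Metric.nhds_basis_closedBall.mem_iff.1 (hΩ.mem_nhds hz)
  choose! R hR0 hRΩ using hR
  let C : ℝ → ℝ := fun r => (volume.real (Metric.ball (0 : Fin d → ℂ) r))⁻¹ *
    volume.real (Metric.ball (0 : Fin d → ℂ) r) ^ (1 / 2 : ℝ)
  have hC0 : ∀ r, 0 ≤ C r := fun r => by positivity
  have hlim0 : Filter.Tendsto (fun n => ‖g n - g₀‖) Filter.atTop (𝓝 0) :=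
    tendsto_iff_norm_sub_tendsto_zero.1 hlim
  have hdiff : ∀ z r, 0 < r → Metric.closedBall z r ⊆ Ω → ∀ n m,
      ‖f n z - f m z‖ ≤ C r * ‖g n - g m‖ := by
    intro z r hr hz n m
    rw [← ballAverage_of_mem hΩ (hf n) (hgf n) hr hz, ← ballAverage_of_mem hΩ (hf m) (hgf m) hr hz,
      ← ballAverage_sub]
    exact norm_ballAverage_le _ _ _
  let F : (Fin d → ℂ) → ℂ := fun z => ballAverage Ω z (R z) g₀
  have hF : ∀ z ∈ Ω, Filter.Tendsto (fun n => f n z) Filter.atTop (𝓝 (F z)) := by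
    intro z hz
    rw [tendsto_iff_norm_sub_tendsto_zero]
    have h1 := hlim0.const_mul (C (R z))
    rw [mul_zero] at h1
    refine squeeze_zero (fun _ => norm_nonneg _) (fun n => ?_) h1
    rw [← ballAverage_of_mem hΩ (hf n) (hgf n) (hR0 z hz) (hRΩ z hz), ← ballAverage_sub]
    exact norm_ballAverage_le _ _ _
  have hFd : DifferentiableOn ℂ F Ω := by
    intro z₀ hz₀
    refine DifferentiableAt.differentiableWithinAt ?_
    -- One third for each of: moving from `z₀` to `z`, the Cauchy estimate around `z`, and the
    -- averaging ball around `y`.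
    set ρ := R z₀ / 3 with hρ
    have hρ0 : 0 < ρ := by have := hR0 z₀ hz₀; positivity
    have hball : ∀ z ∈ Metric.ball z₀ ρ, ∀ y ∈ Metric.ball z ρ, Metric.closedBall y ρ ⊆ Ω := by
      intro z hz y hy
      refine (Metric.closedBall_subset_closedBall' ?_).trans (hRΩ z₀ hz₀)
      have h1 := Metric.mem_ball.1 hz
      have h2 := Metric.mem_ball.1 hy
      have h3 := dist_triangle y z z₀
      linarith
    have hmem : ∀ z ∈ Metric.ball z₀ ρ, ∀ y ∈ Metric.ball z ρ, y ∈ Ω := fun z hz y hy =>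
      hball z hz y hy (Metric.mem_closedBall_self hρ0.le)
    have hdiffat : ∀ n, ∀ z ∈ Ω, DifferentiableAt ℂ (f n) z := fun n z hz =>
      (hf n).1.differentiableAt (hΩ.mem_nhds hz)
    have hder : ∀ z ∈ Metric.ball z₀ ρ, ∀ n m,
        ‖fderiv ℂ (f n) z - fderiv ℂ (f m) z‖ ≤ 2 * C ρ / ρ * ‖g n - g m‖ := by
      intro z hz n m
      have hzΩ := hmem z hz z (Metric.mem_ball_self hρ0)
      rw [← fderiv_sub (hdiffat n z hzΩ) (hdiffat m z hzΩ)]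
      have h1 : Set.MapsTo (f n - f m) (Metric.ball z ρ)
          (Metric.closedBall ((f n - f m) z) (2 * C ρ * ‖g n - g m‖)) := by
        intro y hy
        rw [mem_closedBall_iff_norm]
        refine (norm_sub_le _ _).trans ?_
        have h2 := hdiff y ρ hρ0 (hball z hz y hy) n m
        have h3 := hdiff z ρ hρ0 (hball z hz z (Metric.mem_ball_self hρ0)) n m
        simp only [Pi.sub_apply]
        linarith
      refine (Complex.norm_fderiv_le_div_of_mapsTo_ball (fun y hy =>
        ((hdiffat n y (hmem z hz y hy)).sub
          (hdiffat m y (hmem z hz y hy))).differentiableWithinAt) h1 hρ0).trans_eq ?_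
      ring
    have hcau : ∀ ε > 0, ∃ N, ∀ n ≥ N, ∀ m ≥ N, ∀ z ∈ Metric.ball z₀ ρ,
        dist (fderiv ℂ (f n) z) (fderiv ℂ (f m) z) < ε := by
      intro ε hε
      have hpos : 0 < 2 * C ρ / ρ + 1 := by have := hC0 ρ; positivity
      obtain ⟨N, hN⟩ := Metric.cauchySeq_iff.1 hlim.cauchySeq (ε / (2 * C ρ / ρ + 1))
        (by positivity)
      refine ⟨N, fun n hn m hm z hz => ?_⟩
      have h1 := hN n hn m hm
      rw [dist_eq_norm, lt_div_iff₀ hpos] at h1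
      rw [dist_eq_norm]
      refine (hder z hz n m).trans_lt (lt_of_le_of_lt ?_ h1)
      nlinarith [norm_nonneg (g n - g m)]
    have hptc : ∀ z ∈ Metric.ball z₀ ρ, ∃ L, Filter.Tendsto (fun n => fderiv ℂ (f n) z)
        Filter.atTop (𝓝 L) := fun z hz => cauchySeq_tendsto_of_complete (Metric.cauchySeq_iff.2
      fun ε hε => (hcau ε hε).imp fun N hN n hn m hm => hN n hn m hm z hz)
    choose! G hG using hptc
    have hunif : TendstoUniformlyOn (fun n z => fderiv ℂ (f n) z) G Filter.atTop
        (Metric.ball z₀ ρ) := by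
      refine UniformCauchySeqOn.tendstoUniformlyOn_of_tendsto ?_ hG
      rw [Metric.uniformCauchySeqOn_iff]
      exact hcau
    exact (hasFDerivAt_of_tendstoUniformlyOn Metric.isOpen_ball hunif
      (fun n z hz => (hdiffat n z (hmem z hz z (Metric.mem_ball_self hρ0))).hasFDerivAt)
      (fun z hz => hF z (hmem z hz z (Metric.mem_ball_self hρ0)))
      (Metric.mem_ball_self hρ0)).differentiableAt
  have hae : g₀ =ᵐ[volume.restrict Ω] F := by
    obtain ⟨φ, hφ, hφae⟩ := (tendstoInMeasure_of_tendsto_Lp hlim).exists_seq_tendsto_ae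
    have hall : ∀ᵐ z ∂(volume.restrict Ω), ∀ n, g n z = f n z := ae_all_iff.2 hgf
    filter_upwards [hφae, hall, ae_restrict_mem hΩ.measurableSet] with z h1 h2 hz
    simp only [h2] at h1
    exact tendsto_nhds_unique h1 ((hF z hz).comp hφ.tendsto_atTop)
  exact ⟨F, ⟨hFd, (memLp_congr_ae hae).1 (Lp.memLp g₀)⟩, hae⟩

/-- Evaluation at `z` is the inner product with a multiple of the indicator of a ball. Projecting
this vector onto the closed Bergman space gives a holomorphic representative. -/
theorem exists_isBergmanKernel (hΩ : IsOpen Ω) : ∃ K, IsBergmanKernel Ω K := by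
  have hcompl : CompleteSpace (bergmanSpace Ω) := (isClosed_bergmanSpace hΩ).completeSpace_coe
  have h1 : ∀ z ∈ Ω, ∃ k ∈ L2hol Ω, ∀ f ∈ L2hol Ω, f z = ∫ ζ in Ω, conj (k ζ) * f ζ := by
    intro z hz
    obtain ⟨R, hR0, hR⟩ : ∃ R > 0, Metric.closedBall z R ⊆ Ω :=
      Metric.nhds_basis_closedBall.mem_iff.1 (hΩ.mem_nhds hz)
    set V : ℂ := ((volume.real (Metric.ball (0 : Fin d → ℂ) R) : ℝ) : ℂ)⁻¹ with hV
    set u : Lp ℂ 2 (volume.restrict Ω) := indicatorConstLp 2 Metric.isOpen_ball.measurableSet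
        (restrict_ball_ne_top z R) (1 : ℂ) with hu
    set κ := (bergmanSpace Ω).starProjection (conj V • u) with hκ
    obtain ⟨k, hk, hκk⟩ : κ ∈ bergmanSpace Ω := Submodule.starProjection_apply_mem _ _
    refine ⟨k, hk, fun f hf => ?_⟩
    set g := hf.2.toLp f with hg
    have hgf : g =ᵐ[volume.restrict Ω] f := hf.2.coeFn_toLp
    have hgm : g ∈ bergmanSpace Ω := ⟨f, hf, hgf⟩
    have h2 : inner ℂ κ g = f z := by
      rw [hκ, Submodule.inner_starProjection_left_eq_right,
        Submodule.starProjection_eq_self_iff.2 hgm, inner_smul_left, Complex.conj_conj,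
        ← ballAverage_eq, ballAverage_of_mem hΩ hf hgf hR0 hR]
    rw [← h2, L2.inner_def]
    refine integral_congr_ae ?_
    filter_upwards [hκk, hgf] with ζ h3 h4
    rw [h3, h4, RCLike.inner_apply, mul_comm]
  choose! k hk hrep using h1
  classical
  refine ⟨fun z ζ => if z ∈ Ω ∧ ζ ∈ Ω then conj (k z ζ) else 0, fun z ζ h => if_neg h,
    fun z hz => ⟨⟨?_, ?_⟩, fun f hf => ?_⟩⟩
  · refine (hk z hz).1.congr fun ζ hζ => ?_
    simp [hz, hζ]
  · refine (memLp_congr_ae ?_).1 (hk z hz).2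
    filter_upwards [ae_restrict_mem hΩ.measurableSet] with ζ hζ
    simp [hz, hζ]
  · rw [hrep z hz f hf]
    refine setIntegral_congr_fun hΩ.measurableSet fun ζ hζ => ?_
    simp [hz, hζ]

theorem isBergmanKernel_bergmanKernel (hΩ : IsOpen Ω) : IsBergmanKernel Ω (bergmanKernel Ω) :=
  Classical.epsilon_spec (exists_isBergmanKernel hΩ)

/-- The kernel reproduces its own conjugate, so the diagonal value is an integral of `|K(z, ·)|²`.
-/
lemma bergmanKernel_self_re_nonneg (hΩ : IsOpen Ω) {z : Fin d → ℂ} (hz : z ∈ Ω) :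
    0 ≤ (bergmanKernel Ω z z).re := by
  obtain ⟨h1, h2⟩ := (isBergmanKernel_bergmanKernel hΩ).2 z hz
  have h3 := h2 _ h1
  have h4 : ∀ ζ, bergmanKernel Ω z ζ * conj (bergmanKernel Ω z ζ) =
      ((Complex.normSq (bergmanKernel Ω z ζ) : ℝ) : ℂ) := fun ζ => Complex.mul_conj _
  simp only [h4] at h3
  rw [integral_complex_ofReal] at h3
  have h5 := congrArg Complex.re h3
  simp only [Complex.conj_re] at h5
  rw [h5]
  exact integral_nonneg fun ζ => Complex.normSq_nonneg _

lemma bergmanKernel_rotate (hΩ : IsOpen Ω)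
    (hcirc : ∀ z ∈ Ω, ∀ θ : ℝ, Complex.exp (θ * Complex.I) • z ∈ Ω) {z : Fin d → ℂ}
    (hz : z ∈ Ω) (θ : ℝ) :
    (bergmanKernel Ω (Complex.exp (θ * Complex.I) • z) (Complex.exp (θ * Complex.I) • z)).re =
      (bergmanKernel Ω z z).re := by
  set T : (Fin d → ℂ) → (Fin d → ℂ) := fun v => Complex.exp (θ * Complex.I) • v with hT
  set T' : (Fin d → ℂ) → (Fin d → ℂ) := fun v => Complex.exp ((-θ : ℝ) * Complex.I) • v with hT'
  have hTT' : ∀ v, T (T' v) = v := fun v => by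
    simp only [hT, hT', smul_smul, ← Complex.exp_add]
    push_cast
    rw [neg_mul, add_neg_cancel, Complex.exp_zero, one_smul]
  have hT'T : ∀ v, T' (T v) = v := fun v => by
    simp only [hT, hT', smul_smul, ← Complex.exp_add]
    push_cast
    rw [neg_mul, neg_add_cancel, Complex.exp_zero, one_smul]
  have hpre : ∀ θ : ℝ, (fun v : Fin d → ℂ => Complex.exp (θ * Complex.I) • v) ⁻¹' Ω = Ω := by
    intro θ
    ext v
    refine ⟨fun h => ?_, fun h => hcirc v h θ⟩
    have h1 := hcirc _ h (-θ)
    push_cast at h1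
    rwa [smul_smul, ← Complex.exp_add, neg_mul, neg_add_cancel, Complex.exp_zero, one_smul] at h1
  have hcomp : ∀ (θ : ℝ) {f : (Fin d → ℂ) → ℂ}, f ∈ L2hol Ω →
      (fun v => f (Complex.exp (θ * Complex.I) • v)) ∈ L2hol Ω := by
    intro θ f hf
    refine ⟨hf.1.comp (by fun_prop) fun v hv => hcirc v hv θ, ?_⟩
    have hmp := (measurePreserving_rotate (d := d) θ).restrict_preimage_emb
      (measurableEmbedding_rotate θ) Ω
    rw [hpre] at hmp
    exact hf.2.comp_measurePreserving hmp
  obtain ⟨h1, h2⟩ := (isBergmanKernel_bergmanKernel hΩ).2 z hz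
  obtain ⟨h3, h4⟩ := (isBergmanKernel_bergmanKernel hΩ).2 (T z) (hcirc z hz θ)
  -- The kernel at `z` is tested on the rotated kernel at `T z`, and vice versa. A change of
  -- variables makes the two integrals conjugate, so the diagonal values agree.
  have h5 := h2 _ (hcomp θ h3)
  have h6 := h4 _ (hcomp (-θ) h1)
  have h7 := (measurePreserving_rotate (d := d) θ).setIntegral_preimage_emb
    (measurableEmbedding_rotate θ)
    (fun ζ => bergmanKernel Ω (T z) ζ * conj (bergmanKernel Ω z (T' ζ))) Ω
  rw [hpre] at h7
  have h8 : conj (bergmanKernel Ω z (T' (T z))) =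
      conj (conj (bergmanKernel Ω (T z) (T z))) := by
    rw [show conj (bergmanKernel Ω z (T' (T z))) = _ from h6, h5, ← integral_conj]
    refine h7.symm.trans (integral_congr_ae (Filter.Eventually.of_forall fun ζ => ?_))
    change bergmanKernel Ω (T z) (T ζ) * conj (bergmanKernel Ω z (T' (T ζ))) =
      conj (bergmanKernel Ω z ζ * conj (bergmanKernel Ω (T z) (T ζ)))
    rw [hT'T, map_mul, Complex.conj_conj, mul_comm]
  rw [hT'T, Complex.conj_conj] at h8
  have h9 := congrArg Complex.re h8
  rw [Complex.conj_re] at h9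
  exact h9.symm

/-- Reproducing the constant `1` gives `∫ K(0, ζ) = 1`. The mean value property over the balanced
set `Ω` evaluates the conjugate of that integral as `V(Ω) conj K(0, 0)`. -/
lemma volume_mul_bergmanKernel_zero (hΩ : IsOpen Ω) (hb : Bornology.IsBounded Ω)
    (h0 : (0 : Fin d → ℂ) ∈ Ω) (hbal : ∀ v ∈ Ω, ∀ t : ℂ, ‖t‖ ≤ 1 → t • v ∈ Ω) :
    volume.real Ω * (bergmanKernel Ω 0 0).re = 1 := by
  have hfin : volume Ω ≠ ⊤ := hb.measure_lt_top.ne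
  have : IsFiniteMeasure (volume.restrict Ω) :=
    ⟨by rwa [Measure.restrict_apply_univ, lt_top_iff_ne_top]⟩
  obtain ⟨h1, h2⟩ := (isBergmanKernel_bergmanKernel hΩ).2 0 h0
  have h3 := h2 (fun _ => 1) ⟨differentiableOn_const 1, memLp_const 1⟩
  have h4 := setIntegral_eq_of_balanced (S := Ω) (z := 0) hΩ.measurableSet hbal hΩ (by simp) h1.1
    (by simpa using! h1.2.integrable (by norm_num))
  simp only [zero_add, mul_one] at h3 h4
  rw [integral_conj, ← h3, map_one] at h4
  have h5 := congrArg Complex.re h4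
  simpa using h5.symm

end kernel

/-! ### Rotation invariant potentials -/

lemma coeff_eq_zero_of_rotate {n : ℕ} {b : Matrix (Fin n → ℕ) (Fin n → ℕ) ℂ} {r : ℝ}
    {F : (Fin n → ℂ) → (Fin n → ℂ) → ℂ} (hr : 0 < r) (h : HasExp b r F)
    (hrot : ∀ θ : ℝ, ∀ᶠ x in 𝓝 (0 : Fin n → ℂ),
      F (Complex.exp (θ * Complex.I) • x) (star (Complex.exp (θ * Complex.I) • x)) =
        F x (star x)) {α : Fin n → ℕ} (hα : α ≠ 0) : b α 0 = 0 ∧ b 0 α = 0 := by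
  have key : ∀ θ : ℝ, ∀ α β, b α β * Complex.exp (θ * Complex.I) ^ mdeg α *
      conj (Complex.exp (θ * Complex.I)) ^ mdeg β = b α β := by
    intro θ
    set u := Complex.exp (θ * Complex.I) with hu
    have ht : Filter.Tendsto (fun x : Fin n → ℂ => u • x) (𝓝 0) (𝓝 0) := by
      simpa using (continuous_const_smul u : Continuous fun x : Fin n → ℂ => u • x).tendsto 0
    have h1 : (fun α β => b α β * u ^ mdeg α * conj u ^ mdeg β : Matrix _ _ ℂ) = b := by
      refine eq_of_hasSum_star (f := fun x => F x (star x)) ?_ (h.eventually_hasSum hr)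
      filter_upwards [ht.eventually (h.eventually_hasSum hr), hrot θ] with x h2 h3
      rw [h3] at h2
      refine h2.congr_fun fun m => ?_
      rw [monomial_smul, monomial_smul, map_mul, map_pow]
      ring
    exact fun α β => congrFun (congrFun h1 α) β
  have hn : (mdeg α : ℂ) ≠ 0 := by
    exact_mod_cast fun h => hα (mdeg_eq_zero.1 h)
  -- Rotation multiplies the coefficient of a pure monomial of degree `|α|` by `e^{± i|α|θ}`. The
  -- angle `π / |α|` makes this `-1`.
  have hexp : Complex.exp ((Real.pi / mdeg α : ℝ) * Complex.I) ^ mdeg α = -1 := by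
    rw [← Complex.exp_nat_mul, ← Complex.exp_pi_mul_I]
    congr 1
    push_cast
    field_simp
  have h1 := key (Real.pi / mdeg α) α 0
  have h2 := key (Real.pi / mdeg α) 0 α
  rw [← map_pow] at h2
  rw [hexp] at h1 h2
  simp only [mdeg_zero, pow_zero, mul_one, map_neg, map_one, mul_neg] at h1 h2
  exact ⟨self_eq_neg.1 h1.symm, self_eq_neg.1 h2.symm⟩

lemma apply_zero_of_coeff {n : ℕ} {b : Matrix (Fin n → ℕ) (Fin n → ℕ) ℂ} {r : ℝ}
    {F : (Fin n → ℂ) → (Fin n → ℂ) → ℂ} (hr : 0 < r) (h : HasExp b r F)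
    (h0 : ∀ α, α ≠ 0 → b α 0 = 0 ∧ b 0 α = 0) {x : Fin n → ℂ} (hx : ‖x‖ ≤ r) :
    F x 0 = b 0 0 ∧ F 0 x = b 0 0 := by
  have hz : ‖(0 : Fin n → ℂ)‖ ≤ r := by simpa using hr.le
  refine ⟨(h.hasSum x 0 hx hz).unique ?_, (h.hasSum 0 x hz hx).unique ?_⟩
  · convert hasSum_single ((0 : Fin n → ℕ), (0 : Fin n → ℕ)) ?_ using 1
    · simp [monomial_zero]
    · rintro ⟨α, β⟩ hm
      by_cases hβ : β = 0
      · have hα : α ≠ 0 := fun hα => hm (by rw [hα, hβ])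
        simp [hβ, (h0 α hα).1]
      · simp [monomial_apply_zero, hβ]
  · convert hasSum_single ((0 : Fin n → ℕ), (0 : Fin n → ℕ)) ?_ using 1
    · simp [monomial_zero]
    · rintro ⟨α, β⟩ hm
      by_cases hα : α = 0
      · have hβ : β ≠ 0 := fun hβ => hm (by rw [hα, hβ])
        simp [hα, (h0 β hβ).2]
      · simp [monomial_apply_zero, hα]

/-! ### Metrics of potentials -/

lemma metricOfPotential_congr {n : ℕ} {Φ Φ' : (Fin n → ℂ) → ℝ} {z : Fin n → ℂ}
    (h : Φ =ᶠ[𝓝 z] Φ') : metricOfPotential Φ z = metricOfPotential Φ' z := by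
  ext j k
  refine dz_congr ?_ j
  filter_upwards [h.eventually_nhds] with x hx
  exact dzbar_congr (hx.mono fun y hy => by simp only [hy]) k

lemma metricOfPotential_mul_add {n : ℕ} (a C : ℝ) (Φ : (Fin n → ℂ) → ℝ) (z : Fin n → ℂ) :
    metricOfPotential (fun x => a * Φ x + C) z = a • metricOfPotential Φ z := by
  have h1 : ∀ (f : (Fin n → ℂ) → ℂ) x, fderiv ℝ (fun x => a • f x) x = a • fderiv ℝ f x :=
    fun f x => congrFun (fderiv_const_smul_field (𝕜 := ℝ) (f := f) a) x
  have h2 : ∀ k : Fin n, dzbar k (fun x => ((a * Φ x + C : ℝ) : ℂ)) =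
      fun x => a • dzbar k (fun x => (Φ x : ℂ)) x := by
    intro k
    funext x
    have h3 : (fun x => ((a * Φ x + C : ℝ) : ℂ)) = fun x => a • (Φ x : ℂ) + (C : ℂ) := by
      funext x; simp
    rw [h3, dzbar, dzbar, fderiv_add_const, h1]
    simp only [smul_apply, Complex.real_smul]
    ring
  ext j k
  rw [Matrix.smul_apply, metricOfPotential, h2, metricOfPotential, dz, dz, h1]
  simp only [smul_apply, Complex.real_smul]
  ring

/-! ### The Cartan–Hartogs potential and the equivalence. -/

section main

variable {d γ : ℕ} {Ω : Set (Fin d → ℂ)}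

lemma IsBoundedSymmetricDomain.zero_mem (hΩ : IsBoundedSymmetricDomain Ω) :
    (0 : Fin d → ℂ) ∈ Ω := by
  obtain ⟨z, hz⟩ := hΩ.nonempty
  have h1 := hΩ.circular z hz Real.pi
  rw [Complex.exp_pi_mul_I, neg_one_smul] at h1
  have h2 := hΩ.convex hz h1 (a := 1 / 2) (b := 1 / 2) (by norm_num) (by norm_num) (by norm_num)
  simpa using h2

lemma IsBoundedSymmetricDomain.balanced (hΩ : IsBoundedSymmetricDomain Ω) :
    ∀ v ∈ Ω, ∀ t : ℂ, ‖t‖ ≤ 1 → t • v ∈ Ω := by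
  intro v hv t ht
  have h1 := hΩ.convex (hΩ.circular v hv t.arg) hΩ.zero_mem (a := ‖t‖) (b := 1 - ‖t‖)
    (norm_nonneg t) (by linarith) (by ring)
  rw [smul_zero, add_zero, ← Complex.coe_smul, smul_smul, Complex.norm_mul_exp_arg_mul_I] at h1
  exact h1

/-- Nonnegativity comes from the reproducing property, and the genus equation excludes zero. -/
lemma normalizedKernel_pos (hΩ : IsBoundedSymmetricDomain Ω) (hγ : IsGenus Ω γ) {z : Fin d → ℂ}
    (hz : z ∈ Ω) : 0 < normalizedKernel Ω z := by
  obtain ⟨-, N, -, hN⟩ := hγ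
  refine lt_of_le_of_ne (mul_nonneg measureReal_nonneg
    (bergmanKernel_self_re_nonneg hΩ.isOpen hz)) fun h => ?_
  have h1 := hN z hz
  rw [← h, Complex.ofReal_zero, mul_zero] at h1
  exact zero_ne_one h1

lemma normalizedKernel_zero (hΩ : IsBoundedSymmetricDomain Ω) :
    normalizedKernel Ω (0 : Fin d → ℂ) = 1 :=
  volume_mul_bergmanKernel_zero hΩ.isOpen hΩ.isBounded hΩ.zero_mem hΩ.balanced

lemma normalizedKernel_rotate (hΩ : IsBoundedSymmetricDomain Ω) {z : Fin d → ℂ} (hz : z ∈ Ω)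
    (θ : ℝ) : normalizedKernel Ω (Complex.exp (θ * Complex.I) • z) = normalizedKernel Ω z := by
  rw [normalizedKernel, normalizedKernel, bergmanKernel_rotate hΩ.isOpen hΩ.circular hz]

/-- The polarization of `log (V(Ω) K(z, z))`. -/
theorem exists_polarization (hΩ : IsBoundedSymmetricDomain Ω) (hγ : IsGenus Ω γ) :
    ∃ l : (Fin d → ℂ) × (Fin d → ℂ) → ℂ, (∀ z ∈ Ω, AnalyticAt ℂ l (z, star z)) ∧
      ∀ z ∈ Ω, l (z, star z) = (Real.log (normalizedKernel Ω z) : ℂ) := by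
  obtain ⟨-, N, -, hN⟩ := id hγ
  have hval : ∀ z ∈ Ω, MvPolynomial.eval (Sum.elim z (star z)) N ^ γ =
      (((normalizedKernel Ω z)⁻¹ : ℝ) : ℂ) := fun z hz => by
    have h1 : (normalizedKernel Ω z : ℂ) ≠ 0 := by
      exact_mod_cast (normalizedKernel_pos hΩ hγ hz).ne'
    push_cast
    exact eq_inv_of_mul_eq_one_left (hN z hz)
  -- The logarithm is taken of `N ^ γ`, since it is this power that the genus equation makes
  -- positive on the antidiagonal.
  refine ⟨fun q => -Complex.log (MvPolynomial.eval (Sum.elim q.1 q.2) N ^ γ), fun z hz => ?_,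
    fun z hz => ?_⟩
  · refine AnalyticAt.neg (AnalyticAt.clog (AnalyticAt.pow ?_ γ) ?_)
    · refine AnalyticAt.aeval_mvPolynomial (f := fun q : (Fin d → ℂ) × (Fin d → ℂ) =>
        (Sum.elim q.1 q.2 : Fin d ⊕ Fin d → ℂ)) (fun s => ?_) N
      rcases s with i | i
      · exact ((ContinuousLinearMap.proj i : (Fin d → ℂ) →L[ℂ] ℂ).analyticAt _).comp analyticAt_fst
      · exact ((ContinuousLinearMap.proj i : (Fin d → ℂ) →L[ℂ] ℂ).analyticAt _).comp analyticAt_snd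
    · rw [hval z hz, Complex.ofReal_mem_slitPlane]
      exact inv_pos.2 (normalizedKernel_pos hΩ hγ hz)
  · simp only [hval z hz]
    rw [← Complex.ofReal_log (inv_pos.2 (normalizedKernel_pos hΩ hγ hz)).le, Real.log_inv]
    simp

lemma smul_bergmanMetric (hΩ : IsBoundedSymmetricDomain Ω) (hγ : IsGenus Ω γ) (a : ℝ)
    {z : Fin d → ℂ} (hz : z ∈ Ω) :
    metricOfPotential (fun z => a * Real.log (normalizedKernel Ω z)) z =
      (a • bergmanMetric Ω) z := by
  have h1 : (fun z => a * Real.log (normalizedKernel Ω z)) =ᶠ[𝓝 z]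
      fun z => a * Real.log (bergmanKernel Ω z z).re + a * Real.log (volume.real Ω) := by
    filter_upwards [hΩ.isOpen.mem_nhds hz] with x hx
    have h2 := normalizedKernel_pos hΩ hγ hx
    rw [normalizedKernel] at h2
    rw [normalizedKernel, Real.log_mul (left_ne_zero_of_mul h2.ne') (right_ne_zero_of_mul h2.ne')]
    ring
  rw [metricOfPotential_congr h1, metricOfPotential_mul_add]
  rfl

lemma genericNorm_rpow (hΩ : IsBoundedSymmetricDomain Ω) (hγ : IsGenus Ω γ) (μ : ℝ)
    {z : Fin d → ℂ} (hz : z ∈ Ω) :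
    genericNorm Ω γ z ^ μ = normalizedKernel Ω z ^ (-(μ / γ)) := by
  rw [genericNorm, ← Real.rpow_mul (normalizedKernel_pos hΩ hγ hz).le]
  congr 1
  ring

/-- In this form membership is exactly the convergence condition of the binomial series. -/
lemma mem_domain_iff (hΩ : IsBoundedSymmetricDomain Ω) (hγ : IsGenus Ω γ) {μ : ℝ}
    {X : Fin (d + 1) → ℂ} : X ∈ domain Ω γ μ ↔ base X ∈ Ω ∧
      ‖X (Fin.last d)‖ ^ 2 * normalizedKernel Ω (base X) ^ (μ / γ) < 1 := by
  refine and_congr_right fun hX => ?_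
  have hpos := Real.rpow_pos_of_pos (normalizedKernel_pos hΩ hγ hX) (μ / γ)
  rw [genericNorm_rpow hΩ hγ μ hX, Real.rpow_neg (normalizedKernel_pos hΩ hγ hX).le,
    ← one_div, lt_div_iff₀ hpos]

lemma potential_eq (hΩ : IsBoundedSymmetricDomain Ω) (hγ : IsGenus Ω γ) {μ : ℝ}
    {X : Fin (d + 1) → ℂ} (hX : X ∈ domain Ω γ μ) :
    potential Ω γ μ X = μ / γ * Real.log (normalizedKernel Ω (base X)) -
      Real.log (1 - ‖X (Fin.last d)‖ ^ 2 * normalizedKernel Ω (base X) ^ (μ / γ)) := by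
  obtain ⟨h1, h2⟩ := (mem_domain_iff hΩ hγ).1 hX
  have hL := normalizedKernel_pos hΩ hγ h1
  have hpos := Real.rpow_pos_of_pos hL (μ / γ)
  have h3 : genericNorm Ω γ (base X) ^ μ - ‖X (Fin.last d)‖ ^ 2 =
      normalizedKernel Ω (base X) ^ (-(μ / γ)) *
        (1 - ‖X (Fin.last d)‖ ^ 2 * normalizedKernel Ω (base X) ^ (μ / γ)) := by
    rw [genericNorm_rpow hΩ hγ μ h1, Real.rpow_neg hL.le]
    field_simp
  rw [potential, h3, Real.log_mul (Real.rpow_pos_of_pos hL _).ne' (by linarith),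
    Real.log_rpow hL]
  ring

/-- The polarization of the potential of a Cartan–Hartogs domain, in terms of that of its base. -/
def fiberPolarization (l : (Fin d → ℂ) × (Fin d → ℂ) → ℂ)
    (q : (Fin (d + 1) → ℂ) × (Fin (d + 1) → ℂ)) : ℂ :=
  l (base q.1, base q.2) -
    Complex.log (1 - q.1 (Fin.last d) * q.2 (Fin.last d) * Complex.exp (l (base q.1, base q.2)))

lemma analyticAt_base_pair {l : (Fin d → ℂ) × (Fin d → ℂ) → ℂ} {P : Fin (d + 1) → ℂ}
    (hl : AnalyticAt ℂ l (base P, star (base P))) :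
    AnalyticAt ℂ (fun q : (Fin (d + 1) → ℂ) × (Fin (d + 1) → ℂ) => l (base q.1, base q.2))
      (P, star P) := by
  let B : (Fin (d + 1) → ℂ) →L[ℂ] (Fin d → ℂ) :=
    ContinuousLinearMap.pi fun i => ContinuousLinearMap.proj i.castSucc
  exact AnalyticAt.fun_comp (g := l)
    (f := fun q : (Fin (d + 1) → ℂ) × (Fin (d + 1) → ℂ) => (B q.1, B q.2)) hl
    (((B.analyticAt _).comp analyticAt_fst).prod ((B.analyticAt _).comp analyticAt_snd))

lemma analyticAt_fiber_term {l : (Fin d → ℂ) × (Fin d → ℂ) → ℂ} {P : Fin (d + 1) → ℂ}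
    (hl : AnalyticAt ℂ l (base P, star (base P))) :
    AnalyticAt ℂ (fun q : (Fin (d + 1) → ℂ) × (Fin (d + 1) → ℂ) =>
      q.1 (Fin.last d) * q.2 (Fin.last d) * Complex.exp (l (base q.1, base q.2)))
      (P, star P) := by
  let B : (Fin (d + 1) → ℂ) →L[ℂ] ℂ := ContinuousLinearMap.proj (Fin.last d)
  exact (((B.analyticAt _).comp analyticAt_fst).mul ((B.analyticAt _).comp analyticAt_snd)).mul
    (analyticAt_base_pair hl).cexp

lemma eventually_base_mem (hΩ : IsOpen Ω) {P : Fin (d + 1) → ℂ} (hP : base P ∈ Ω) :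
    ∀ᶠ X in 𝓝 P, base X ∈ Ω := by
  have : Continuous (base : (Fin (d + 1) → ℂ) → (Fin d → ℂ)) :=
    continuous_pi fun i => continuous_apply _
  exact this.continuousAt.eventually (hΩ.mem_nhds hP)

section polarization

variable {l : (Fin d → ℂ) × (Fin d → ℂ) → ℂ} {μ : ℝ} {P : Fin (d + 1) → ℂ}

lemma fiber_term_eq (hΩ : IsBoundedSymmetricDomain Ω) (hγ : IsGenus Ω γ)
    (hlΩ : ∀ z ∈ Ω, l (z, star z) = ((μ / γ * Real.log (normalizedKernel Ω z) : ℝ) : ℂ))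
    {X : Fin (d + 1) → ℂ} (hX : base X ∈ Ω) :
    X (Fin.last d) * (star X) (Fin.last d) * Complex.exp (l (base X, base (star X))) =
      ((‖X (Fin.last d)‖ ^ 2 * normalizedKernel Ω (base X) ^ (μ / γ) : ℝ) : ℂ) := by
  have h1 : base (star X) = star (base X) := rfl
  rw [h1, hlΩ _ hX, Real.rpow_def_of_pos (normalizedKernel_pos hΩ hγ hX), Pi.star_apply,
    RCLike.star_def, Complex.mul_conj, Complex.normSq_eq_norm_sq, mul_comm (Real.log _)]
  push_cast
  rfl

/-- Continuity of the kernel on the diagonal is drawn from the analytic polarization. -/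
lemma eventually_mem_domain (hΩ : IsBoundedSymmetricDomain Ω) (hγ : IsGenus Ω γ)
    (hl : ∀ z ∈ Ω, AnalyticAt ℂ l (z, star z))
    (hlΩ : ∀ z ∈ Ω, l (z, star z) = ((μ / γ * Real.log (normalizedKernel Ω z) : ℝ) : ℂ))
    (hP : P ∈ domain Ω γ μ) : ∀ᶠ X in 𝓝 P, X ∈ domain Ω γ μ := by
  obtain ⟨h1, h2⟩ := (mem_domain_iff hΩ hγ).1 hP
  have h0 : ∀ X : Fin (d + 1) → ℂ, base X ∈ Ω →
      0 ≤ ‖X (Fin.last d)‖ ^ 2 * normalizedKernel Ω (base X) ^ (μ / γ) := fun X hX =>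
    mul_nonneg (sq_nonneg _) (Real.rpow_nonneg (normalizedKernel_pos hΩ hγ hX).le _)
  have h3 : Filter.Tendsto (fun X : Fin (d + 1) → ℂ =>
      ‖X (Fin.last d) * (star X) (Fin.last d) * Complex.exp (l (base X, base (star X)))‖) (𝓝 P)
      (𝓝 ‖P (Fin.last d) * (star P) (Fin.last d) * Complex.exp (l (base P, base (star P)))‖) :=
    ((analyticAt_fiber_term (hl _ h1)).continuousAt.tendsto.comp (tendsto_antidiagonal P)).norm
  rw [fiber_term_eq hΩ hγ hlΩ h1, Complex.norm_real, Real.norm_of_nonneg (h0 P h1)] at h3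
  filter_upwards [h3.eventually_lt_const h2, eventually_base_mem hΩ.isOpen h1] with X h4 h5
  rw [fiber_term_eq hΩ hγ hlΩ h5, Complex.norm_real, Real.norm_of_nonneg (h0 X h5)] at h4
  exact (mem_domain_iff hΩ hγ).2 ⟨h5, h4⟩

lemma fiberPolarization_eq (hΩ : IsBoundedSymmetricDomain Ω) (hγ : IsGenus Ω γ)
    (hlΩ : ∀ z ∈ Ω, l (z, star z) = ((μ / γ * Real.log (normalizedKernel Ω z) : ℝ) : ℂ))
    {X : Fin (d + 1) → ℂ} (hX : X ∈ domain Ω γ μ) :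
    fiberPolarization l (X, star X) = (potential Ω γ μ X : ℂ) := by
  obtain ⟨h1, h2⟩ := (mem_domain_iff hΩ hγ).1 hX
  have h3 : base (star X) = star (base X) := rfl
  rw [fiberPolarization, fiber_term_eq hΩ hγ hlΩ h1, h3, hlΩ _ h1, potential_eq hΩ hγ hX,
    Complex.ofReal_sub, Complex.ofReal_log (by linarith)]
  push_cast
  rfl

lemma analyticAt_fiberPolarization (hΩ : IsBoundedSymmetricDomain Ω) (hγ : IsGenus Ω γ)
    (hl : ∀ z ∈ Ω, AnalyticAt ℂ l (z, star z))
    (hlΩ : ∀ z ∈ Ω, l (z, star z) = ((μ / γ * Real.log (normalizedKernel Ω z) : ℝ) : ℂ))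
    (hP : P ∈ domain Ω γ μ) : AnalyticAt ℂ (fiberPolarization l) (P, star P) := by
  obtain ⟨h1, h2⟩ := (mem_domain_iff hΩ hγ).1 hP
  refine (analyticAt_base_pair (hl _ h1)).sub
    ((analyticAt_const.sub (analyticAt_fiber_term (hl _ h1))).clog ?_)
  change 1 - P (Fin.last d) * (star P) (Fin.last d) *
    Complex.exp (l (base P, base (star P))) ∈ Complex.slitPlane
  rw [fiber_term_eq hΩ hγ hlΩ h1, ← Complex.ofReal_one, ← Complex.ofReal_sub,
    Complex.ofReal_mem_slitPlane]
  linarith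

end polarization

lemma zero_mem_domain (hΩ : IsBoundedSymmetricDomain Ω) (hγ : IsGenus Ω γ) (μ : ℝ)
    {z : Fin d → ℂ} (hz : z ∈ Ω) : (Fin.snoc z 0 : Fin (d + 1) → ℂ) ∈ domain Ω γ μ := by
  have hb : base (Fin.snoc z 0 : Fin (d + 1) → ℂ) = z := by funext i; simp [base]
  rw [mem_domain_iff hΩ hγ, hb]
  exact ⟨hz, by simp⟩

/-- The potential is invariant under rotations and vanishes at `0`, so its polarization has no terms
in one variable alone. The terms that the diastasis subtracts are therefore zero. -/
theorem isDiastasisAt_potential (hΩ : IsBoundedSymmetricDomain Ω) (hγ : IsGenus Ω γ) (μ : ℝ) :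
    IsDiastasisAt (metric Ω γ μ) 0 (potential Ω γ μ) := by
  obtain ⟨l₀, hl₀, hl₀Ω⟩ := exists_polarization hΩ hγ
  set l : (Fin d → ℂ) × (Fin d → ℂ) → ℂ := fun q => ((μ / γ : ℝ) : ℂ) * l₀ q with hldef
  have hl : ∀ z ∈ Ω, AnalyticAt ℂ l (z, star z) := fun z hz => analyticAt_const.mul (hl₀ z hz)
  have hlΩ : ∀ z ∈ Ω, l (z, star z) = ((μ / γ * Real.log (normalizedKernel Ω z) : ℝ) : ℂ) :=
    fun z hz => by rw [hldef, Complex.ofReal_mul, ← hl₀Ω z hz]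
  have h0 : (0 : Fin (d + 1) → ℂ) ∈ domain Ω γ μ := by
    rw [mem_domain_iff hΩ hγ]
    exact ⟨hΩ.zero_mem, by simp⟩
  have hΨ := analyticAt_fiberPolarization hΩ hγ hl hlΩ h0
  have hdom := eventually_mem_domain hΩ hγ hl hlΩ h0
  have hΦ : ∀ᶠ X in 𝓝 0, fiberPolarization l (X, star X) = (potential Ω γ μ X : ℂ) :=
    hdom.mono fun X hX => fiberPolarization_eq hΩ hγ hlΩ hX
  obtain ⟨r, hr, b, hb⟩ := exists_hasExp hΨ
  simp only [star_zero, zero_add] at hb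
  have hrot : ∀ θ : ℝ, ∀ᶠ X in 𝓝 (0 : Fin (d + 1) → ℂ),
      fiberPolarization l (Complex.exp (θ * Complex.I) • X,
        star (Complex.exp (θ * Complex.I) • X)) = fiberPolarization l (X, star X) := by
    intro θ
    have ht : Filter.Tendsto (fun x : Fin (d + 1) → ℂ => Complex.exp (θ * Complex.I) • x)
        (𝓝 0) (𝓝 0) := by
      simpa using (continuous_const_smul (Complex.exp (θ * Complex.I)) :
        Continuous fun x : Fin (d + 1) → ℂ => Complex.exp (θ * Complex.I) • x).tendsto 0
    filter_upwards [ht.eventually hdom, hdom] with X h1 h2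
    have h3 : base (Complex.exp (θ * Complex.I) • X) = Complex.exp (θ * Complex.I) • base X := rfl
    rw [fiberPolarization_eq hΩ hγ hlΩ h1, fiberPolarization_eq hΩ hγ hlΩ h2,
      potential_eq hΩ hγ h1, potential_eq hΩ hγ h2, h3, normalizedKernel_rotate hΩ h2.1,
      Pi.smul_apply, norm_smul, Complex.norm_exp_ofReal_mul_I, one_mul]
  have hcoeff := fun α hα => coeff_eq_zero_of_rotate hr hb hrot (α := α) hα
  have hpot0 : potential Ω γ μ (0 : Fin (d + 1) → ℂ) = 0 := by
    have h1 : base (0 : Fin (d + 1) → ℂ) = 0 := rfl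
    rw [potential_eq hΩ hγ h0, h1, normalizedKernel_zero hΩ]
    simp
  have h00 : fiberPolarization l ((0 : Fin (d + 1) → ℂ), (0 : Fin (d + 1) → ℂ)) = 0 := by
    have := fiberPolarization_eq hΩ hγ hlΩ h0
    rwa [star_zero, hpot0, Complex.ofReal_zero] at this
  have hb00 : b 0 0 = 0 := by
    rw [← (apply_zero_of_coeff hr hb hcoeff (x := 0) (by simpa using hr.le)).1, h00]
  refine isDiastasisAt_of_polarization hΨ hΦ (Filter.Eventually.of_forall fun _ => rfl) ?_
  filter_upwards [hΦ, Metric.ball_mem_nhds _ hr] with X h1 h2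
  have h3 := (apply_zero_of_coeff hr hb hcoeff (mem_ball_zero_iff.1 h2).le).1
  have h4 := (apply_zero_of_coeff hr hb hcoeff (x := star X)
    (by rw [norm_star]; exact (mem_ball_zero_iff.1 h2).le)).2
  rw [polarDiastasis, star_zero, h3, h4, hb00, h00, h1]
  ring

theorem isProjectivelyInduced_iff (hΩ : IsBoundedSymmetricDomain Ω) (hγ : IsGenus Ω γ) (μ : ℝ)
    {c : ℝ} (hc : 0 < c) :
    IsProjectivelyInduced (domain Ω γ μ) (c • metric Ω γ μ) ↔
      ∀ m : ℕ, IsProjectivelyInduced Ω (((c + m) * (μ / γ)) • bergmanMetric Ω) := by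
  obtain ⟨l₀, hl₀, hl₀Ω⟩ := exists_polarization hΩ hγ
  set l : (Fin d → ℂ) × (Fin d → ℂ) → ℂ := fun q => ((μ / γ : ℝ) : ℂ) * l₀ q with hldef
  have hl : ∀ z ∈ Ω, AnalyticAt ℂ l (z, star z) := fun z hz => analyticAt_const.mul (hl₀ z hz)
  have hlΩ : ∀ z ∈ Ω, l (z, star z) = ((μ / γ * Real.log (normalizedKernel Ω z) : ℝ) : ℂ) :=
    fun z hz => by rw [hldef, Complex.ofReal_mul, ← hl₀Ω z hz]
  -- At each point one family `k` of matrices governs all the metrics on the base and the metric on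
  -- the total space.
  have key : ∀ P ∈ domain Ω γ μ, ∃ k : ℕ → Matrix (Fin d → ℕ) (Fin d → ℕ) ℂ,
      (∀ m : ℕ, IsOneResolvableAt (((c + m) * (μ / γ)) • bergmanMetric Ω) (base P) ↔
        (k m).PosSemidef) ∧
      (∀ α β, Summable fun m =>
        (negBinom c m : ℂ) * fiberCoeff (k m) (P (Fin.last d)) m α β) ∧
      (IsOneResolvableAt (c • metric Ω γ μ) P ↔
        (totalCoeff (negBinom c) k (P (Fin.last d))).PosSemidef) := by
    intro P hP
    obtain ⟨h1, h2⟩ := (mem_domain_iff hΩ hγ).1 hP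
    have hnorm : ‖P (Fin.last d)‖ ^ 2 * ‖Complex.exp (l (base P, star (base P)))‖ < 1 := by
      rwa [hlΩ _ h1, Complex.norm_exp, Complex.ofReal_re, mul_comm (μ / γ : ℝ),
        ← Real.rpow_def_of_pos (normalizedKernel_pos hΩ hγ h1)]
    obtain ⟨r, hr, k, hk, hsum, htot⟩ := exists_hasExp_fibration (hl _ h1) hc hnorm
    refine ⟨k, fun m => ?_, hsum, ?_⟩
    · refine isOneResolvableAt_iff
        (Φ := fun z => (c + m) * (μ / γ) * Real.log (normalizedKernel Ω z))
        (Ψ := fun q => (c + m) * l q) hr (analyticAt_const.mul (hl _ h1)) ?_ ?_ (hk m)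
      · filter_upwards [hΩ.isOpen.mem_nhds h1] with z hz
        rw [hlΩ z hz]
        push_cast
        ring
      · filter_upwards [hΩ.isOpen.mem_nhds h1] with z hz
        exact smul_bergmanMetric hΩ hγ _ hz
    -- The `+ 0` matches the shape of `metricOfPotential_mul_add`.
    · refine isOneResolvableAt_iff (Φ := fun X => c * potential Ω γ μ X + 0)
        (Ψ := fun q => c * fiberPolarization l q) hr
        (analyticAt_const.mul (analyticAt_fiberPolarization hΩ hγ hl hlΩ hP)) ?_ ?_ htot
      · filter_upwards [eventually_mem_domain hΩ hγ hl hlΩ hP] with X hX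
        rw [fiberPolarization_eq hΩ hγ hlΩ hX]
        push_cast
        ring
      · exact Filter.Eventually.of_forall fun X => metricOfPotential_mul_add _ _ _ _
  constructor
  · intro h m z hz
    -- The zero section suffices: over `z`, the point `(z, 0)` isolates each `k m` as a block.
    have hP := zero_mem_domain hΩ hγ μ hz
    obtain ⟨k, hk, -, htot⟩ := key _ hP
    have hb : base (Fin.snoc z 0 : Fin (d + 1) → ℂ) = z := by funext i; simp [base]
    rw [Fin.snoc_last] at htot
    have hm := (hk m).2 (posSemidef_of_totalCoeff (negBinom_pos hc) (htot.1 (h _ hP)) m)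
    rwa [hb] at hm
  · intro h P hP
    obtain ⟨k, hk, hsum, htot⟩ := key P hP
    refine htot.2 (posSemidef_tsum (fun m => ?_) hsum)
    exact (posSemidef_fiberCoeff ((hk m).1 (h m _ hP.1)) _ m).smul
      (a := (negBinom c m : ℂ)) (by exact_mod_cast (negBinom_pos hc m).le)

end main

end CartanHartogs

end

theorem mainTheorem10 {d γ : ℕ} (Ω : Set (Fin d → ℂ))
    (hΩ : CartanHartogs.IsBoundedSymmetricDomain Ω) (hirr : CartanHartogs.IsIrreducible Ω)
    (hγ : CartanHartogs.IsGenus Ω γ) (μ : ℝ) (hμ : 0 < μ) :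
    CartanHartogs.IsDiastasisAt (CartanHartogs.metric Ω γ μ) 0 (CartanHartogs.potential Ω γ μ) ∧
    ∀ c : ℝ, 0 < c →
      (CartanHartogs.IsProjectivelyInduced (CartanHartogs.domain Ω γ μ)
          (c • CartanHartogs.metric Ω γ μ) ↔
        ∀ m : ℕ, CartanHartogs.IsProjectivelyInduced Ω
          (((c + m) * (μ / γ)) • CartanHartogs.bergmanMetric Ω)) :=
  ⟨CartanHartogs.isDiastasisAt_potential hΩ hγ μ, fun _ hc =>
    CartanHartogs.isProjectivelyInduced_iff hΩ hγ μ hc⟩
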